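/- Let $H$ be a countable group, let $\alpha$ be an automorphism of $H$, and let $H\rtimes\mathbb{Z}$ be the corresponding semidirect product, in which the generator $g$ of $\mathbb{Z}$ satisfies $g t g^{-1}=\alpha(t)$ for all $t\in H$. Let $H\rtimes\mathbb{Z}\curvearrowright X$ be a free continuous action on a compact metric space $X$. If the restricted action $H\curvearrowright X$ is almost finite, then the action $H\rtimes\mathbb{Z}\curvearrowright X$ is almost finite. Here an action by homeomorphisms of a group $G$ on a compact metric space $X$ is called \emph{almost finite} if for every integer $n\ge 1$, every finite set $K\subseteq G$ and every $\delta>0$ there are finitely many pairs $(S_i,V_i)$, $i\in I$, where $S_i\subseteq G$ is finite and $V_i\subseteq X$ is open, and sets $S_i'\subseteq S_i$ with $|S_i'|\le |S_i|/n$, such that \begin{enumerate} \item for each $i$ the sets $sV_i$, $s\in S_i$, are pairwise disjoint and of diameter less than $\delta$, and the sets $S_iV_i$, $i\in I$, are pairwise disjoint; \item each $S_i$ is $(K,\delta)$-invariant, that is, $|\{t\in G : Kt\cap S_i\ne\emptyset \text{ and } Kt\cap (G\setminus S_i)\neq\emptyset\}|\le\delta|S_i|$; \item $X\setminus\bigsqcup_{i\in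 I}S_iV_i\prec\bigsqcup_{i\in I}S_i'V_i$, where $A\prec B$ means that for every closed set $C\subseteq A$ there are finitely many open sets $U_1,\dots,U_m\subseteq X$ covering $C$ and elements $s_1,\dots,s_m\in G$ such that the sets $s_1U_1,\dots,s_mU_m$ are pairwise disjoint and contained in $B$. \end{enumerate} -/

import Mathlib

open scoped Pointwise

namespace DynAlmostFinite

variable {G : Type*} [Group G]

/-- The `K`-boundary of `F`: the elements `t` of the group for which `K t` meets both `F` and its
complement. -/
def boundary (K F : Finset G) : Set G :=
  {t | (∃ k ∈ K, k * t ∈ F) ∧ ∃ k ∈ K, k * t ∉ F}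

/-- The boundary is a finite set, so that its `Set.ncard` is its true cardinality. -/
theorem boundary_finite (K F : Finset G) : (boundary K F).Finite := by
  refine ((K.finite_toSet.inv).mul F.finite_toSet).subset ?_
  rintro t ⟨⟨k, hk, hkt⟩, -⟩
  exact Set.mem_mul.2 ⟨k⁻¹, by simpa using hk, k * t, by simpa using hkt, by group⟩

/-- `F` is (left) `(K, δ)`-invariant: `|∂_K F| ≤ δ |F|`. -/
def IsInvariant (K : Finset G) (δ : ℝ) (F : Finset G) : Prop :=
  ((boundary K F).ncard : ℝ) ≤ δ * (F.card : ℝ)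

variable {X : Type*} [MulAction G X]

/-- The set `S V`. -/
def footprint (S : Finset G) (V : Set X) : Set X :=
  ⋃ s ∈ S, s • V

/-- `(S, V)` is a tower: the levels `s V`, for `s ∈ S`, are pairwise disjoint. -/
def IsTower (S : Finset G) (V : Set X) : Prop :=
  ∀ s ∈ S, ∀ t ∈ S, s ≠ t → Disjoint (s • V) (t • V)

/-- A family of pairs `(S i, V i)` is a castle: each pair is a tower, and the footprints of
different towers are disjoint. (The index type is taken finite where this is used.) -/
def IsCastle {ι : Type*} (S : ι → Finset G) (V : ι → Set X) : Prop :=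
  (∀ i, IsTower (S i) (V i)) ∧
    ∀ i j, i ≠ j → Disjoint (footprint (S i) (V i)) (footprint (S j) (V j))

/-- Dynamical subequivalence `A ≺ B` with respect to the action of `G`: every closed subset of `A`
is covered by finitely many open sets having translates by elements of `G` that are pairwise
disjoint and contained in `B`. -/
def Subequiv (G : Type*) [Group G] {X : Type*} [TopologicalSpace X] [MulAction G X]
    (A B : Set X) : Prop :=
  ∀ C : Set X, IsClosed C → C ⊆ A →
    ∃ (m : ℕ) (U : Fin m → Set X) (s : Fin m → G),
      (∀ i, IsOpen (U i)) ∧ C ⊆ ⋃ i, U i ∧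
      (∀ i j, i ≠ j → Disjoint (s i • U i) (s j • U j)) ∧
      ∀ i, s i • U i ⊆ B

/-- Almost finiteness of an action of a group `G` on a compact metric space `X`. -/
def AlmostFinite (G : Type*) [Group G] (X : Type*) [MetricSpace X] [MulAction G X] : Prop :=
  ∀ (n : ℕ), 0 < n → ∀ (K : Finset G) (δ : ℝ), 0 < δ →
    ∃ (m : ℕ) (S : Fin m → Finset G) (V : Fin m → Set X),
      IsCastle S V ∧ (∀ i, IsOpen (V i)) ∧
      (∀ i, IsInvariant K δ (S i)) ∧
      (∀ i, ∀ s ∈ S i, Metric.diam (s • V i) < δ) ∧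
      ∃ S' : Fin m → Finset G,
        (∀ i, S' i ⊆ S i) ∧
        (∀ i, ((S' i).card : ℝ) ≤ ((S i).card : ℝ) / (n : ℝ)) ∧
        Subequiv G (⋃ i, footprint (S i) (V i))ᶜ (⋃ i, footprint (S' i) (V i))

/-- The action of `G` on `X` is free. -/
def IsFreeAction (G : Type*) [Group G] (X : Type*) [MulAction G X] : Prop :=
  ∀ (g : G) (x : X), g • x = x → g = 1

/-- The semidirect product `H ⋊ ℤ` given by an automorphism `α` of `H`: the generator of `ℤ`
(written multiplicatively) acts on `H` by `α`. -/
abbrev SemidirectInt (H : Type*) [Group H] (α : MulAut H) : Type _ :=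
  H ⋊[zpowersHom (MulAut H) α] Multiplicative ℤ

/-- The canonical copy of `H` inside `H ⋊ ℤ`. -/
abbrev baseSubgroup (H : Type*) [Group H] (α : MulAut H) : Subgroup (SemidirectInt H α) :=
  (SemidirectProduct.inl : H →* SemidirectInt H α).range

end DynAlmostFinite

/-! Write `G` for the semidirect product and `g` for the generator of the integers. The main tool is
upper Banach density: a real function has density at most `c` when its averages over sufficiently
invariant finite sets are, uniformly in the point, at most `c` up to an arbitrarily small error.
Bounded functions and their translates have the same density, a single finite set with small
averages already bounds the density, and for closed sets density is upper semicontinuous under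
thickening.

Suppose that `H` is infinite. Almost finiteness of `H` gives three things. It makes `H` amenable. It
gives the small boundary property (`AlmostFinite.exists_nullFrontier`): open sets with boundary of
density zero can be inserted between a closed set and an open neighbourhood of it. It gives
comparison (`AlmostFinite.subequiv_of_upperDensityLE`): by counting levels column by column, a
strict inequality of densities yields subequivalence, even for finitely many sets first moved by
elements of `G`. Boxes of elements `g ^ j * h` are Følner sets of `G`, and the small boundary
property passes from `H` to `G` because a density bound for `H` is one for `G`. An Ornstein–Weiss
quasi-tiling whose tiles have null boundary then gives castles for the free action of `G` with
invariant shapes and a remainder of arbitrarily small density (`exists_castle_upperDensityLE`). It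
remains to push the remainder into a small part of the castle, which needs comparison for `G`. Only
densities averaged along `g` are controlled, so both sets are cut into `N` pieces of nearly equal
relative size (`AlmostFinite.exists_split`) and the `j`-th pieces are read after the shift by `g ^
j`. The resulting sum reproduces the average along `g`, and comparison for `H` applies
(`AlmostFinite.subequiv_extension`).

Suppose that `H` is finite. Then its castles have no remainder and provide a finite partition of `X`
into `H`-invariant clopen sets. A clopen `H`-invariant marker set with return times under `g` in
`[N, 2N)` cuts `X` into towers shaped like boxes, with nothing left over. -/

namespace DynAlmostFinite

open scoped Classical

/-! ### Invariant finite sets and the Følner filter -/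

section Folner

variable {Γ : Type*} [Group Γ]

theorem boundary_mono {K K' : Finset Γ} (F : Finset Γ) (h : K ⊆ K') :
    boundary K F ⊆ boundary K' F := by
  rintro t ⟨⟨k, hk, hkF⟩, k', hk', hkF'⟩
  exact ⟨⟨k, h hk, hkF⟩, k', h hk', hkF'⟩

theorem IsInvariant.mono {K K' F : Finset Γ} {δ δ' : ℝ} (hF : IsInvariant K' δ' F)
    (h : K ⊆ K') (hδ : δ' ≤ δ) : IsInvariant K δ F := by
  have h1 : ((boundary K F).ncard : ℝ) ≤ ((boundary K' F).ncard : ℝ) :=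
    Nat.cast_le.2 (Set.ncard_le_ncard (boundary_mono F h) (boundary_finite K' F))
  exact h1.trans (hF.trans (mul_le_mul_of_nonneg_right hδ (Nat.cast_nonneg _)))

/-- The filter of nonempty finite sets that are more and more invariant. -/
def folner (Γ : Type*) [Group Γ] : Filter (Finset Γ) where
  sets := {s | ∃ K : Finset Γ, ∃ δ : ℝ, 0 < δ ∧
    ∀ F : Finset Γ, F.Nonempty → IsInvariant K δ F → F ∈ s}
  univ_sets := ⟨∅, 1, one_pos, fun _ _ _ => trivial⟩
  sets_of_superset := by
    rintro s t ⟨K, δ, hδ, h⟩ hst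
    exact ⟨K, δ, hδ, fun F h1 h2 => hst (h F h1 h2)⟩
  inter_sets := by
    rintro s t ⟨K, δ, hδ, h⟩ ⟨K', δ', hδ', h'⟩
    exact ⟨K ∪ K', min δ δ', lt_min hδ hδ', fun F h1 h2 =>
      ⟨h F h1 (h2.mono Finset.subset_union_left (min_le_left _ _)),
        h' F h1 (h2.mono Finset.subset_union_right (min_le_right _ _))⟩⟩

theorem eventually_folner {p : Finset Γ → Prop} :
    (∀ᶠ F in folner Γ, p F) ↔ ∃ K : Finset Γ, ∃ δ : ℝ, 0 < δ ∧
      ∀ F : Finset Γ, F.Nonempty → IsInvariant K δ F → p F :=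
  Iff.rfl

theorem eventually_nonempty : ∀ᶠ F in folner Γ, F.Nonempty :=
  eventually_folner.2 ⟨∅, 1, one_pos, fun _ h _ => h⟩

theorem eventually_isInvariant (K : Finset Γ) {δ : ℝ} (hδ : 0 < δ) :
    ∀ᶠ F in folner Γ, IsInvariant K δ F :=
  eventually_folner.2 ⟨K, δ, hδ, fun _ _ h => h⟩

/-- An element of `F` pushed out of `F` by `s` lies in the boundary for the pair `{1, s}`. -/
theorem eventually_card_translate_le (s : Γ) {η : ℝ} (hη : 0 < η) :
    ∀ᶠ F in folner Γ, ((F.filter (fun u => s * u ∉ F)).card : ℝ) ≤ η * F.card := by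
  filter_upwards [eventually_isInvariant {1, s} hη] with F hF
  refine le_trans ?_ hF
  rw [← Set.ncard_coe_finset]
  refine Nat.cast_le.2 (Set.ncard_le_ncard ?_ (boundary_finite _ _))
  intro u hu
  simp only [Finset.coe_filter, Set.mem_ofPred_eq] at hu
  exact ⟨⟨1, by simp, by simpa using hu.1⟩, s, by simp, hu.2⟩

/-- A boundary point `t` has `k * t` in `F` and `k' * t` outside for some pair from `K`, so `u = k *
t` is pushed out of `F` by `k' * k⁻¹`. The factor `|K|²` counts the pairs. -/
theorem isInvariant_of_card_translate_le {K F : Finset Γ} {η δ : ℝ}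
    (h : ∀ k ∈ K, ∀ k' ∈ K, ((F.filter (fun u => k' * k⁻¹ * u ∉ F)).card : ℝ) ≤ η * F.card)
    (hδ : (K.card : ℝ) * K.card * η ≤ δ) : IsInvariant K δ F := by
  have hsub : boundary K F ⊆ ((K ×ˢ K).biUnion fun p =>
      (F.filter (fun u => p.2 * p.1⁻¹ * u ∉ F)).image (fun u => p.1⁻¹ * u) : Finset Γ) := by
    rintro t ⟨⟨k, hk, hkF⟩, k', hk', hkF'⟩
    simp only [Finset.coe_biUnion, Set.mem_iUnion]
    refine ⟨(k, k'), by simpa using ⟨hk, hk'⟩, ?_⟩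
    simp only [Finset.coe_image, Finset.coe_filter, Set.mem_image, Set.mem_ofPred_eq]
    exact ⟨k * t, ⟨hkF, by simpa [mul_assoc] using hkF'⟩, by group⟩
  have h1 := Set.ncard_le_ncard hsub (Finset.finite_toSet _)
  rw [Set.ncard_coe_finset] at h1
  have h2 : ((boundary K F).ncard : ℝ) ≤ ∑ p ∈ K ×ˢ K, η * F.card := by
    refine (Nat.cast_le.2 (h1.trans Finset.card_biUnion_le)).trans ?_
    push_cast
    refine Finset.sum_le_sum fun p hp => ?_
    rw [Finset.mem_product] at hp
    exact (Nat.cast_le.2 Finset.card_image_le).trans (h p.1 hp.1 p.2 hp.2)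
  refine h2.trans ?_
  rw [Finset.sum_const, Finset.card_product, nsmul_eq_mul]
  push_cast
  rw [← mul_assoc]
  exact mul_le_mul_of_nonneg_right hδ (Nat.cast_nonneg _)

theorem boundary_map (e : Γ ≃* Γ) (K F : Finset Γ) :
    boundary (K.map e.toEquiv.toEmbedding) (F.map e.toEquiv.toEmbedding) = e '' boundary K F := by
  ext t
  obtain ⟨t, rfl⟩ := e.surjective t
  simp only [boundary, Finset.mem_map, Set.mem_ofPred_eq, Set.mem_image]
  constructor
  · rintro ⟨⟨_, ⟨k, hk, rfl⟩, ⟨u, hu, h⟩⟩, _, ⟨k', hk', rfl⟩, h'⟩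
    refine ⟨t, ⟨⟨k, hk, ?_⟩, k', hk', fun hF => h' ⟨k' * t, hF, by simp⟩⟩, rfl⟩
    have : u = k * t := e.injective (by simpa using h)
    exact this ▸ hu
  · rintro ⟨t', ⟨⟨k, hk, h⟩, k', hk', h'⟩, ht⟩
    obtain rfl : t' = t := e.injective ht
    refine ⟨⟨_, ⟨k, hk, rfl⟩, ⟨k * t', h, by simp⟩⟩, _, ⟨k', hk', rfl⟩, ?_⟩
    rintro ⟨u, hu, hu'⟩
    have : u = k' * t' := e.injective (by simpa using hu')
    exact h' (this ▸ hu)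

theorem IsInvariant.map (e : Γ ≃* Γ) {K F : Finset Γ} {δ : ℝ} (h : IsInvariant K δ F) :
    IsInvariant (K.map e.toEquiv.toEmbedding) δ (F.map e.toEquiv.toEmbedding) := by
  unfold IsInvariant at *
  rwa [boundary_map, Set.ncard_image_of_injective _ e.injective, Finset.card_map]

/-- Automorphisms carry boundaries to boundaries. This is applied to conjugation on a normal
subgroup. -/
theorem tendsto_map_folner (e : Γ ≃* Γ) :
    Filter.Tendsto (fun F : Finset Γ => F.map e.toEquiv.toEmbedding) (folner Γ) (folner Γ) := by
  rintro s ⟨K, δ, hδ, h⟩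
  refine ⟨K.map e.symm.toEquiv.toEmbedding, δ, hδ, fun F hF hK => h _ (hF.map) ?_⟩
  have := hK.map e
  rwa [Finset.map_map, show (e.symm.toEquiv.toEmbedding.trans e.toEquiv.toEmbedding) =
    Function.Embedding.refl Γ by ext; simp, Finset.map_refl] at this

/-- If `F` has fewer than `M` elements, invariance with constant `1 / (M + 1)` forces its boundary
to be empty; a nonempty `F` then contains a translate of a set with `M` elements. Large shapes make
rounding errors negligible later. -/
theorem eventually_le_card [Infinite Γ] (M : ℕ) : ∀ᶠ F in folner Γ, M ≤ F.card := by
  obtain ⟨K, hK⟩ := Infinite.exists_subset_card_eq Γ M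
  filter_upwards [eventually_isInvariant (insert 1 K) (δ := 1 / (M + 1)) (by positivity),
    eventually_nonempty] with F hF ⟨t, ht⟩
  by_contra hlt
  push Not at hlt
  have h0 : ((boundary (insert 1 K) F).ncard : ℝ) < 1 := by
    refine lt_of_le_of_lt hF ?_
    rw [div_mul_eq_mul_div, one_mul, div_lt_one (by positivity)]
    exact_mod_cast hlt.trans (Nat.lt_succ_self M)
  have h1 : boundary (insert 1 K) F = ∅ := by
    rw [← Set.ncard_eq_zero (boundary_finite _ _)]
    have : (boundary (insert 1 K) F).ncard < 1 := by exact_mod_cast h0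
    omega
  have h2 : K.map (mulRightEmbedding t) ⊆ F := by
    intro u hu
    obtain ⟨k, hk, rfl⟩ := Finset.mem_map.1 hu
    by_contra hn
    have : t ∈ boundary (insert 1 K) F :=
      ⟨⟨1, by simp, by simpa using ht⟩, k, by simp [hk], hn⟩
    rw [h1] at this
    exact this
  have h3 := Finset.card_le_card h2
  rw [Finset.card_map, hK] at h3
  omega

end Folner

/-! ### Upper Banach density -/

section Density

/-- The indicator function of a set, with real values. -/
noncomputable def ind {X : Type*} (A : Set X) : X → ℝ := A.indicator 1

theorem ind_of_mem {X : Type*} {A : Set X} {x : X} (h : x ∈ A) : ind A x = 1 := by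
  simp [ind, h]

theorem ind_of_notMem {X : Type*} {A : Set X} {x : X} (h : x ∉ A) : ind A x = 0 := by
  simp [ind, h]

theorem ind_nonneg {X : Type*} (A : Set X) (x : X) : 0 ≤ ind A x := by
  by_cases h : x ∈ A
  · simp [ind_of_mem h]
  · simp [ind_of_notMem h]

theorem ind_le_one {X : Type*} (A : Set X) (x : X) : ind A x ≤ 1 := by
  by_cases h : x ∈ A
  · simp [ind_of_mem h]
  · simp [ind_of_notMem h]

theorem abs_ind_le_one {X : Type*} (A : Set X) (x : X) : |ind A x| ≤ 1 := by
  rw [abs_of_nonneg (ind_nonneg A x)]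
  exact ind_le_one A x

theorem ind_mono {X : Type*} {A B : Set X} (h : A ⊆ B) (x : X) : ind A x ≤ ind B x := by
  by_cases hx : x ∈ A
  · rw [ind_of_mem hx, ind_of_mem (h hx)]
  · rw [ind_of_notMem hx]; exact ind_nonneg B x

theorem ind_compl {X : Type*} (A : Set X) (x : X) : ind Aᶜ x = 1 - ind A x := by
  by_cases hx : x ∈ A
  · rw [ind_of_mem hx, ind_of_notMem (by simpa using hx)]; ring
  · rw [ind_of_notMem hx, ind_of_mem (by simpa using hx)]; ring

theorem ind_iUnion_le {X ι : Type*} (s : Finset ι) (A : ι → Set X) (B : Set X)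
    (h : B ⊆ ⋃ i ∈ s, A i) (x : X) : ind B x ≤ ∑ i ∈ s, ind (A i) x := by
  by_cases hx : x ∈ B
  · obtain ⟨i, hi, hxi⟩ := Set.mem_iUnion₂.1 (h hx)
    rw [ind_of_mem hx, ← ind_of_mem hxi]
    exact Finset.single_le_sum (f := fun i => ind (A i) x) (fun j _ => ind_nonneg _ _) hi
  · rw [ind_of_notMem hx]
    exact Finset.sum_nonneg fun j _ => ind_nonneg _ _

theorem sum_ind_le {X ι : Type*} (s : Finset ι) (A : ι → Set X) (B : Set X)
    (hd : ∀ i ∈ s, ∀ j ∈ s, i ≠ j → Disjoint (A i) (A j)) (h : ∀ i ∈ s, A i ⊆ B) (x : X) :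
    ∑ i ∈ s, ind (A i) x ≤ ind B x := by
  by_cases hx : ∃ i ∈ s, x ∈ A i
  · obtain ⟨i, hi, hxi⟩ := hx
    rw [Finset.sum_eq_single_of_mem i hi, ind_of_mem hxi, ind_of_mem (h i hi hxi)]
    intro j hj hji
    exact ind_of_notMem fun hxj => Set.disjoint_left.1 (hd j hj i hi hji) hxj hxi
  · push Not at hx
    rw [Finset.sum_eq_zero fun i hi => ind_of_notMem (hx i hi)]
    exact ind_nonneg _ _

variable {Γ : Type*} [Group Γ] {X : Type*} [MulAction Γ X]

theorem ind_smul (s : Γ) (A : Set X) (x : X) : ind (s • A) x = ind A (s⁻¹ • x) := by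
  by_cases h : s⁻¹ • x ∈ A
  · rw [ind_of_mem h, ind_of_mem (Set.mem_smul_set_iff_inv_smul_mem.2 h)]
  · rw [ind_of_notMem h, ind_of_notMem (fun h' => h (Set.mem_smul_set_iff_inv_smul_mem.1 h'))]

theorem sum_ind_eq_card (F : Finset Γ) (A : Set X) (x : X) :
    ∑ t ∈ F, ind A (t • x) = ((F.filter fun t => t • x ∈ A).card : ℝ) := by
  rw [Finset.card_filter]
  push_cast
  refine Finset.sum_congr rfl fun t _ => ?_
  by_cases h : t • x ∈ A
  · simp [ind_of_mem h, h]
  · simp [ind_of_notMem h, h]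

/-- The upper Banach density of `f` with respect to the action of `Γ` is at most `c`. -/
def UpperDensityLE (Γ : Type*) [Group Γ] {X : Type*} [MulAction Γ X] (f : X → ℝ) (c : ℝ) : Prop :=
  ∀ η : ℝ, 0 < η → ∀ᶠ F in folner Γ, ∀ x : X, ∑ t ∈ F, f (t • x) ≤ (c + η) * F.card

namespace UpperDensityLE

variable {f f' : X → ℝ} {c c' : ℝ}

theorem mono (h : UpperDensityLE Γ f c) (hf : ∀ x, f' x ≤ f x) (hc : c ≤ c') :
    UpperDensityLE Γ f' c' := by
  intro η hη
  filter_upwards [h η hη] with F hF x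
  refine (Finset.sum_le_sum fun t _ => hf (t • x)).trans ((hF x).trans ?_)
  gcongr

theorem add (h : UpperDensityLE Γ f c) (h' : UpperDensityLE Γ f' c') :
    UpperDensityLE Γ (fun x => f x + f' x) (c + c') := by
  intro η hη
  filter_upwards [h (η / 2) (half_pos hη), h' (η / 2) (half_pos hη)] with F hF hF' x
  rw [Finset.sum_add_distrib]
  linarith [hF x, hF' x]

theorem const_mul (h : UpperDensityLE Γ f c) {a : ℝ} (ha : 0 ≤ a) :
    UpperDensityLE Γ (fun x => a * f x) (a * c) := by
  intro η hη
  have ha' : 0 < a + 1 := by linarith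
  filter_upwards [h (η / (a + 1)) (by positivity)] with F hF x
  rw [← Finset.mul_sum]
  calc a * ∑ t ∈ F, f (t • x) ≤ a * ((c + η / (a + 1)) * F.card) :=
        mul_le_mul_of_nonneg_left (hF x) ha
    _ = (a * c + a / (a + 1) * η) * F.card := by ring
    _ ≤ (a * c + η) * F.card := by
        gcongr
        have : a / (a + 1) ≤ 1 := by rw [div_le_one ha']; linarith
        nlinarith

variable (Γ) in
theorem of_le (h : ∀ x, f x ≤ c) : UpperDensityLE Γ f c := by
  intro η hη
  refine Filter.Eventually.of_forall fun F x => ?_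
  refine (Finset.sum_le_card_nsmul _ _ _ fun t _ => h (t • x)).trans ?_
  rw [nsmul_eq_mul, mul_comm]
  gcongr
  linarith

theorem sum {ι : Type*} (s : Finset ι) {f : ι → X → ℝ} {c : ι → ℝ}
    (h : ∀ i ∈ s, UpperDensityLE Γ (f i) (c i)) :
    UpperDensityLE Γ (fun x => ∑ i ∈ s, f i x) (∑ i ∈ s, c i) := by
  induction s using Finset.induction_on with
  | empty => simpa using of_le Γ (f := fun _ : X => 0) (c := 0) (fun _ => le_rfl)
  | insert a s ha ih =>
    simp only [Finset.sum_insert ha]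
    exact (h a (by simp)).add (ih fun i hi => h i (by simp [hi]))

theorem of_forall_lt (h : ∀ c', c < c' → UpperDensityLE Γ f c') : UpperDensityLE Γ f c := by
  intro η hη
  filter_upwards [h (c + η / 2) (by linarith) (η / 2) (by linarith)] with F hF x
  exact (hF x).trans_eq (by ring)

/-- A bounded function and its translates have the same density. -/
theorem sub_smul {M : ℝ} (hM : ∀ x, |f x| ≤ M) (s : Γ) :
    UpperDensityLE Γ (fun x => f x - f (s • x)) 0 := by
  intro η hη
  have hM' : 0 < |M| + 1 := by positivity
  have hη' : 0 < η / (2 * (|M| + 1)) := by positivity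
  filter_upwards [eventually_card_translate_le s hη', eventually_card_translate_le s⁻¹ hη']
    with F h1 h2 x
  -- The two sums cancel on the overlap of `F` and its translate, so only the few elements leaving
  -- `F` contribute.
  have key : ∑ t ∈ F.filter (fun t => s⁻¹ * t ∈ F), f (t • x) =
      ∑ t ∈ F.filter (fun t => s * t ∈ F), f (s • t • x) := by
    refine Finset.sum_nbij' (fun t => s⁻¹ * t) (fun t => s * t) ?_ ?_ ?_ ?_ ?_
    · intro t ht; simp only [Finset.mem_filter] at ht ⊢; simpa using ht.symm
    · intro t ht; simp only [Finset.mem_filter] at ht ⊢; simpa using ht.symm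
    · intro t _; simp
    · intro t _; simp
    · intro t _; simp [smul_smul]
  rw [Finset.sum_sub_distrib,
    ← Finset.sum_filter_add_sum_filter_not F (fun t => s⁻¹ * t ∈ F) (fun t => f (t • x)),
    ← Finset.sum_filter_add_sum_filter_not F (fun t => s * t ∈ F) (fun t => f (s • t • x)), key]
  have b1 : ∑ t ∈ F.filter (fun t => s⁻¹ * t ∉ F), f (t • x) ≤
      (F.filter (fun t => s⁻¹ * t ∉ F)).card * (|M| + 1) := by
    rw [← nsmul_eq_mul]
    exact Finset.sum_le_card_nsmul _ _ _ fun t _ => by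
      linarith [le_abs_self (f (t • x)), hM (t • x), le_abs_self M]
  have b2 : -((F.filter (fun t => s * t ∉ F)).card * (|M| + 1)) ≤
      ∑ t ∈ F.filter (fun t => s * t ∉ F), f (s • t • x) := by
    rw [← mul_neg, ← nsmul_eq_mul]
    exact Finset.card_nsmul_le_sum _ _ _ fun t _ => by
      linarith [neg_abs_le (f (s • t • x)), hM (s • t • x), le_abs_self M]
  have e : η / (2 * (|M| + 1)) * F.card * (|M| + 1) = η / 2 * F.card := by
    field_simp
  have c1 := mul_le_mul_of_nonneg_right h1 hM'.le
  have c2 := mul_le_mul_of_nonneg_right h2 hM'.le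
  linarith

theorem smul_sub {M : ℝ} (hM : ∀ x, |f x| ≤ M) (s : Γ) :
    UpperDensityLE Γ (fun x => f (s • x) - f x) 0 := by
  refine (sub_smul (f := fun x => f (s • x)) (M := M) (fun x => hM _) s⁻¹).mono (fun x => ?_) le_rfl
  simp

theorem comp_smul {M : ℝ} (hM : ∀ x, |f x| ≤ M) (h : UpperDensityLE Γ f c) (s : Γ) :
    UpperDensityLE Γ (fun x => f (s • x)) c :=
  ((smul_sub hM s).add h).mono (fun x => by simp) (by simp)

/-- A bound for the averages over a single finite set is a bound for the density. -/
theorem of_sum_le {M : ℝ} (hM : ∀ x, |f x| ≤ M) {F : Finset Γ} (hF : F.Nonempty)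
    (h : ∀ x, ∑ t ∈ F, f (t • x) ≤ c * F.card) : UpperDensityLE Γ f c := by
  have hc : (0 : ℝ) < F.card := Nat.cast_pos.2 hF.card_pos
  -- Write `f` as its average over `F` plus the average of the differences `f x - f (t • x)`, each
  -- of density zero.
  have h1 := ((sum F fun t _ => sub_smul hM t).const_mul (inv_nonneg.2 hc.le)).add
    (of_le Γ (f := fun x => (F.card : ℝ)⁻¹ * ∑ t ∈ F, f (t • x)) (c := c) fun x => by
      rw [inv_mul_le_iff₀ hc, mul_comm]; exact h x)
  refine h1.mono (fun x => ?_) (by simp)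
  rw [Finset.sum_sub_distrib, Finset.sum_const, nsmul_eq_mul]
  field_simp
  linarith

/-- Together with `of_sum_le` this turns a density bound, at the price of any increase of the
constant, into an inequality over one finite set. Compactness arguments and the change of group both
rest on it. -/
theorem exists_sum_le [(folner Γ).NeBot] (h : UpperDensityLE Γ f c) (hc : c < c') :
    ∃ F : Finset Γ, F.Nonempty ∧ ∀ x : X, ∑ t ∈ F, f (t • x) ≤ c' * F.card := by
  obtain ⟨F, hF, hF'⟩ := ((h (c' - c) (by linarith)).and eventually_nonempty).exists
  exact ⟨F, hF', fun x => (hF x).trans_eq (by ring)⟩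

end UpperDensityLE

/-- Passage from a subgroup to the whole group. -/
theorem UpperDensityLE.of_subgroup {H : Subgroup Γ} [(folner H).NeBot] {f : X → ℝ} {c M : ℝ}
    (hM : ∀ x, |f x| ≤ M) (h : UpperDensityLE H f c) : UpperDensityLE Γ f c := by
  refine UpperDensityLE.of_forall_lt fun c' hc => ?_
  -- A single finite subset of `H` with small averages is also a finite subset of the whole group.
  obtain ⟨F, hF, hF'⟩ := h.exists_sum_le hc
  refine UpperDensityLE.of_sum_le hM (F := F.map (Function.Embedding.subtype _)) hF.map fun x => ?_
  rw [Finset.sum_map, Finset.card_map]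
  exact hF' x

/-- The density with respect to a normal subgroup is invariant under the whole group. -/
theorem UpperDensityLE.comp_smul_normal {H : Subgroup Γ} [H.Normal] {f : X → ℝ} {c : ℝ}
    (h : UpperDensityLE H f c) (g : Γ) : UpperDensityLE H (fun x => f (g • x)) c := by
  intro η hη
  -- Since `g t x = (g t g⁻¹) (g x)`, averaging over `F` at `x` amounts to averaging over the
  -- conjugate of `F` at `g x`.
  filter_upwards [(tendsto_map_folner (MulAut.conjNormal g : H ≃* H)).eventually (h η hη)]
    with F hF x
  have := hF (g • x)
  rw [Finset.card_map, Finset.sum_map] at this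
  refine le_trans (le_of_eq (Finset.sum_congr rfl fun t _ => ?_)) this
  congr 1
  change g • ((t : Γ) • x) = ((MulAut.conjNormal g t : H) : Γ) • (g • x)
  rw [MulAut.conjNormal_apply, smul_smul, smul_smul]
  congr 1
  group

end Density

/-! ### Semicontinuity of density under thickening -/

section Thickening

open Filter Topology Metric

/-- The indicator of the `δ`-thickening of a closed set is upper semicontinuous jointly in `(δ, x)`
at `δ = 0`, and compactness of `X` makes the resulting bound uniform in `x`. -/
theorem eventually_cthickening_sum_le {X κ : Type*} [MetricSpace X] [CompactSpace X]
    (s : Finset κ) (A : κ → Set X) (hA : ∀ k, IsClosed (A k)) (φ : κ → X → X)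
    (hφ : ∀ k, Continuous (φ k)) (c : ℝ) (h : ∀ x, ∑ k ∈ s, ind (A k) (φ k x) ≤ c) :
    ∀ᶠ δ in 𝓝 (0 : ℝ), ∀ x, ∑ k ∈ s, ind (cthickening δ (A k)) (φ k x) ≤ c := by
  have key := isCompact_univ.eventually_forall_of_forall_eventually (X := ℝ) (Y := X) (x₀ := 0)
    (P := fun δ x => ∑ k ∈ s, ind (cthickening δ (A k)) (φ k x) ≤ c) (K := Set.univ) ?_
  · filter_upwards [key] with δ hδ x using hδ x trivial
  intro x _
  have h1 : ∀ k ∈ s, ∀ᶠ z : ℝ × X in 𝓝 ((0 : ℝ), x),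
      ind (cthickening z.1 (A k)) (φ k z.2) ≤ ind (A k) (φ k x) := by
    intro k _
    by_cases hx : φ k x ∈ A k
    · refine Eventually.of_forall fun z => ?_
      rw [ind_of_mem hx]
      exact ind_le_one _ _
    · have hopen : IsOpen {z : ℝ × X | ENNReal.ofReal z.1 < infEDist (φ k z.2) (A k)} :=
        isOpen_lt (ENNReal.continuous_ofReal.comp continuous_fst)
          (continuous_infEDist.comp ((hφ k).comp continuous_snd))
      have hmem : ((0 : ℝ), x) ∈ {z : ℝ × X | ENNReal.ofReal z.1 < infEDist (φ k z.2) (A k)} := by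
        change ENNReal.ofReal 0 < infEDist (φ k x) (A k)
        rw [ENNReal.ofReal_zero, infEDist_pos_iff_notMem_closure, (hA k).closure_eq]
        exact hx
      filter_upwards [hopen.mem_nhds hmem] with z hz
      rw [ind_of_notMem hx, ind_of_notMem]
      rw [mem_cthickening_iff, not_le]
      exact hz
  filter_upwards [(Finset.eventually_all s).2 h1] with z hz
  exact (Finset.sum_le_sum hz).trans (h x)

variable {Γ : Type*} [Group Γ] {X : Type*} [MetricSpace X] [CompactSpace X] [MulAction Γ X]
  [ContinuousConstSMul Γ X]

/-- Upper density of a sum of indicators of closed sets is upper semicontinuous. -/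
theorem UpperDensityLE.eventually_cthickening [(folner Γ).NeBot] {κ : Type*} (s : Finset κ)
    (A : κ → Set X) (hA : ∀ k, IsClosed (A k)) (φ : κ → X → X) (hφ : ∀ k, Continuous (φ k))
    {c c' : ℝ} (hc : c < c') (h : UpperDensityLE Γ (fun x => ∑ k ∈ s, ind (A k) (φ k x)) c) :
    ∀ᶠ δ in 𝓝 (0 : ℝ),
      UpperDensityLE Γ (fun x => ∑ k ∈ s, ind (cthickening δ (A k)) (φ k x)) c' := by
  obtain ⟨F, hF, hF'⟩ := h.exists_sum_le hc
  have := eventually_cthickening_sum_le (F ×ˢ s) (fun p => A p.2) (fun p => hA p.2)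
    (fun p x => φ p.2 (p.1 • x)) (fun p => (hφ p.2).comp (continuous_const_smul p.1))
    (c' * F.card) (fun x => by rw [Finset.sum_product]; exact hF' x)
  filter_upwards [this] with δ hδ
  refine UpperDensityLE.of_sum_le (M := s.card) (fun x => ?_) hF fun x => ?_
  · refine (Finset.abs_sum_le_sum_abs _ _).trans ?_
    refine (Finset.sum_le_card_nsmul _ _ 1 fun k _ => abs_ind_le_one _ _).trans ?_
    simp
  · have := hδ x
    rwa [Finset.sum_product] at this

theorem UpperDensityLE.eventually_cthickening_ind [(folner Γ).NeBot] {A : Set X}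
    (hA : IsClosed A) {c c' : ℝ} (hc : c < c') (h : UpperDensityLE Γ (ind A) c) :
    ∀ᶠ δ in 𝓝 (0 : ℝ), UpperDensityLE Γ (ind (cthickening δ A)) c' := by
  have := UpperDensityLE.eventually_cthickening (Γ := Γ) ({()} : Finset Unit) (fun _ => A)
    (fun _ => hA) (fun _ x => x) (fun _ => continuous_id) hc (by simpa using h)
  simpa using this

theorem eventually_nhdsGT_of_nhds {p : ℝ → Prop} (h : ∀ᶠ δ in 𝓝 (0 : ℝ), p δ) :
    ∃ δ : ℝ, 0 < δ ∧ p δ :=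
  (((h.filter_mono nhdsWithin_le_nhds).and self_mem_nhdsWithin : ∀ᶠ δ in 𝓝[>] (0 : ℝ),
    p δ ∧ δ ∈ Set.Ioi (0 : ℝ)).exists).imp fun _ h => ⟨h.2, h.1⟩

end Thickening

/-! ### Towers, castles and mass transport inside columns -/

section Castle

variable {Γ : Type*} [Group Γ] {X : Type*} [MulAction Γ X] {ι : Type*}

theorem mem_footprint {S : Finset Γ} {V : Set X} {x : X} :
    x ∈ footprint S V ↔ ∃ s ∈ S, x ∈ s • V := by
  simp [footprint]

theorem footprint_mono {S T : Finset Γ} {V W : Set X} (h : S ⊆ T) (hV : V ⊆ W) :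
    footprint S V ⊆ footprint T W := by
  intro x hx
  obtain ⟨s, hs, hx⟩ := mem_footprint.1 hx
  exact mem_footprint.2 ⟨s, h hs, Set.smul_set_mono hV hx⟩

theorem IsTower.mono {S T : Finset Γ} {V W : Set X} (h : IsTower T W) (hST : S ⊆ T)
    (hV : V ⊆ W) : IsTower S V := fun s hs t ht hst =>
  (h s (hST hs) t (hST ht) hst).mono (Set.smul_set_mono hV) (Set.smul_set_mono hV)

/-- Points of a tower have unique coordinates. -/
theorem IsTower.unique {S : Finset Γ} {V : Set X} (h : IsTower S V) {s t : Γ} (hs : s ∈ S)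
    (ht : t ∈ S) {v w : X} (hv : v ∈ V) (hw : w ∈ V) (he : s • v = t • w) : s = t ∧ v = w := by
  have hst : s = t := by
    by_contra hne
    exact Set.disjoint_left.1 (h s hs t ht hne) (Set.smul_mem_smul_set hv)
      (he ▸ Set.smul_mem_smul_set hw)
  subst hst
  exact ⟨rfl, smul_left_cancel s he⟩

theorem IsCastle.mono {S T : ι → Finset Γ} {V W : ι → Set X} (h : IsCastle T W)
    (hST : ∀ i, S i ⊆ T i) (hV : ∀ i, V i ⊆ W i) : IsCastle S V :=
  ⟨fun i => (h.1 i).mono (hST i) (hV i), fun i j hij =>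
    (h.2 i j hij).mono (footprint_mono (hST i) (hV i)) (footprint_mono (hST j) (hV j))⟩

theorem IsCastle.disjoint_levels {S : ι → Finset Γ} {V : ι → Set X} (h : IsCastle S V)
    {i j : ι} {s t : Γ} (hs : s ∈ S i) (ht : t ∈ S j) (hne : (i, s) ≠ (j, t)) :
    Disjoint (s • V i) (t • V j) := by
  by_cases hij : i = j
  · subst hij
    exact h.1 i s hs t ht fun hst => hne (by rw [hst])
  · exact (h.2 i j hij).mono (fun x hx => mem_footprint.2 ⟨s, hs, hx⟩)
      (fun x hx => mem_footprint.2 ⟨t, ht, hx⟩)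

theorem IsCastle.sum_ind [Fintype ι] {S : ι → Finset Γ} {V : ι → Set X} (h : IsCastle S V)
    (x : X) : ∑ i, ∑ s ∈ S i, ind (s • V i) x = ind (⋃ i, footprint (S i) (V i)) x := by
  rw [Finset.sum_sigma']
  refine le_antisymm ?_ ?_
  · refine sum_ind_le _ (fun p : (_ : ι) × Γ => p.2 • V p.1) _ ?_ ?_ x
    · rintro ⟨i, s⟩ hi ⟨j, t⟩ hj hne
      simp only [Finset.mem_sigma, Finset.mem_univ, true_and] at hi hj
      refine h.disjoint_levels hi hj fun he => hne ?_
      cases he; rfl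
    · rintro ⟨i, s⟩ hi y hy
      simp only [Finset.mem_sigma, Finset.mem_univ, true_and] at hi
      exact Set.mem_iUnion.2 ⟨i, mem_footprint.2 ⟨s, hi, hy⟩⟩
  · refine ind_iUnion_le _ (fun p : (_ : ι) × Γ => p.2 • V p.1) _ ?_ x
    intro y hy
    obtain ⟨i, hi⟩ := Set.mem_iUnion.1 hy
    obtain ⟨s, hs, hy⟩ := mem_footprint.1 hi
    exact Set.mem_iUnion₂.2 ⟨⟨i, s⟩, by simpa using hs, hy⟩

/-- Moving mass within the columns of a family of towers does not change densities. -/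
theorem UpperDensityLE.of_weights (I : Finset ι) (L : ι → Finset Γ) (w : ι → Γ → ℝ)
    (V : ι → Set X) (h : ∀ i ∈ I, ∑ s ∈ L i, w i s ≤ 0) :
    UpperDensityLE Γ (fun x => ∑ i ∈ I, ∑ s ∈ L i, w i s * ind (s • V i) x) 0 := by
  -- Every level of a column is moved back to its base at no cost in density; what remains is the
  -- total weight of the column times the indicator of the base.
  have h1 : UpperDensityLE Γ (fun x => ∑ i ∈ I, ∑ s ∈ L i,
      (w i s * ind (V i) (s⁻¹ • x) - w i s * ind (V i) x)) (∑ i ∈ I, ∑ s ∈ L i, 0) :=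
    UpperDensityLE.sum I fun i _ => UpperDensityLE.sum (L i) fun s _ =>
      UpperDensityLE.smul_sub (f := fun x => w i s * ind (V i) x) (M := |w i s|)
        (fun x => by
          rw [abs_mul]
          exact mul_le_of_le_one_right (abs_nonneg _) (abs_ind_le_one _ _)) s⁻¹
  have h2 : UpperDensityLE Γ (fun x => ∑ i ∈ I, (∑ s ∈ L i, w i s) * ind (V i) x) 0 :=
    UpperDensityLE.of_le Γ fun x => Finset.sum_nonpos fun i hi =>
      mul_nonpos_of_nonpos_of_nonneg (h i hi) (ind_nonneg _ _)
  refine (h1.add h2).mono (fun x => le_of_eq ?_) (by simp)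
  rw [← Finset.sum_add_distrib]
  refine Finset.sum_congr rfl fun i _ => ?_
  rw [Finset.sum_mul, ← Finset.sum_add_distrib]
  refine Finset.sum_congr rfl fun s _ => ?_
  rw [ind_smul]
  ring

/-- Comparison of the densities of two families of levels of the same castle. -/
theorem UpperDensityLE.of_card_le [Fintype ι] (S T : ι → Finset Γ) (a : ℝ) (V : ι → Set X)
    (h : ∀ i, ((S i).card : ℝ) ≤ a * (T i).card) :
    UpperDensityLE Γ (fun x => ∑ i, ∑ s ∈ S i, ind (s • V i) x -
      a * ∑ i, ∑ s ∈ T i, ind (s • V i) x) 0 := by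
  have := UpperDensityLE.of_weights Finset.univ (fun i => S i ∪ T i)
    (fun i s => (if s ∈ S i then 1 else 0) - a * (if s ∈ T i then 1 else 0)) V (fun i _ => by
      rw [Finset.sum_sub_distrib, ← Finset.mul_sum, Finset.sum_ite_mem, Finset.sum_ite_mem,
        Finset.union_inter_cancel_left, Finset.union_inter_cancel_right]
      simpa using h i)
  refine this.mono (fun x => le_of_eq ?_) le_rfl
  rw [Finset.mul_sum, ← Finset.sum_sub_distrib]
  refine Finset.sum_congr rfl fun i _ => ?_
  simp only [sub_mul, ite_mul, one_mul, zero_mul, mul_assoc]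
  rw [Finset.sum_sub_distrib, ← Finset.mul_sum, Finset.sum_ite_mem, Finset.sum_ite_mem,
    Finset.union_inter_cancel_left, Finset.union_inter_cancel_right]

end Castle

/-! ### First consequences of almost finiteness -/

section AlmostFinite

variable {Γ : Type*} [Group Γ] {X : Type*} [MetricSpace X] [MulAction Γ X]

theorem Subequiv.of_finite {A B : Set X} (h : ∀ C : Set X, IsClosed C → C ⊆ A →
    ∃ (κ : Type*) (_ : Finite κ) (U : κ → Set X) (s : κ → Γ), (∀ i, IsOpen (U i)) ∧
      C ⊆ ⋃ i, U i ∧ (∀ i j, i ≠ j → Disjoint (s i • U i) (s j • U j)) ∧ ∀ i, s i • U i ⊆ B) :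
    Subequiv Γ A B := by
  intro C hC hCA
  obtain ⟨κ, hκ, U, s, h1, h2, h3, h4⟩ := h C hC hCA
  obtain ⟨m, ⟨e⟩⟩ := Finite.exists_equiv_fin κ
  refine ⟨m, U ∘ e.symm, s ∘ e.symm, fun i => h1 _, ?_, fun i j hij => h3 _ _ (by simpa using hij),
    fun i => h4 _⟩
  intro x hx
  obtain ⟨i, hi⟩ := Set.mem_iUnion.1 (h2 hx)
  exact Set.mem_iUnion.2 ⟨e i, by simpa using hi⟩

/-- If some invariance condition had no nonempty solution, all shapes would be empty, and the
nonempty space `X` would be subequivalent to the empty set. -/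
theorem AlmostFinite.neBot_folner (h : AlmostFinite Γ X) [Nonempty X] : (folner Γ).NeBot := by
  refine Filter.neBot_iff.2 fun hbot => ?_
  have h0 : ∀ᶠ F in folner Γ, False := by simp [hbot]
  obtain ⟨K, δ, hδ, hK⟩ := eventually_folner.1 h0
  obtain ⟨m, S, V, -, -, hS, -, S', hS', -, hsub⟩ := h 1 one_pos K δ hδ
  have hem : ∀ i, S i = ∅ := fun i => by
    by_contra hne
    exact hK _ (Finset.nonempty_iff_ne_empty.2 hne) (hS i)
  have hem' : ∀ i, S' i = ∅ := fun i => Finset.subset_empty.1 (hem i ▸ hS' i)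
  obtain ⟨p, U, s, -, hcov, -, hU⟩ := hsub Set.univ isClosed_univ (by simp [footprint, hem])
  obtain ⟨x⟩ := ‹Nonempty X›
  obtain ⟨k, hk⟩ := Set.mem_iUnion.1 (hcov (Set.mem_univ x))
  have := hU k (Set.smul_mem_smul_set hk)
  simp [footprint, hem'] at this

/-- As `A` is closed, the cover may be taken for `A` itself. Its members have the densities of their
translates, which are disjoint inside `B`. -/
theorem Subequiv.upperDensityLE {A B : Set X} (hA : IsClosed A) (h : Subequiv Γ A B) {c : ℝ}
    (hB : UpperDensityLE Γ (ind B) c) : UpperDensityLE Γ (ind A) c := by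
  obtain ⟨m, U, s, -, hcov, hdisj, hsub⟩ := h A hA le_rfl
  have h1 := (UpperDensityLE.sum Finset.univ fun i _ =>
    UpperDensityLE.sub_smul (abs_ind_le_one (U i)) (s i)⁻¹).add hB
  have h3 : UpperDensityLE Γ (fun x => ∑ i, (ind (U i) x - ind (U i) ((s i)⁻¹ • x)) +
      ∑ i, ind (s i • U i) x) (∑ i : Fin m, 0 + c) :=
    h1.mono (fun x => by
      have := sum_ind_le Finset.univ (fun i => s i • U i) B (fun i _ j _ => hdisj i j)
        (fun i _ => hsub i) x
      simpa using this) le_rfl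
  refine h3.mono (fun x => ?_) (by simp)
  rw [← Finset.sum_add_distrib]
  refine (ind_iUnion_le Finset.univ U A (by simpa using hcov) x).trans (le_of_eq ?_)
  refine Finset.sum_congr rfl fun i _ => ?_
  rw [ind_smul]
  ring

variable [ContinuousConstSMul Γ X]

theorem isOpen_footprint (S : Finset Γ) {V : Set X} (hV : IsOpen V) : IsOpen (footprint S V) :=
  isOpen_biUnion fun s _ => hV.smul s

theorem isClosed_remainder {ι : Type*} (S : ι → Finset Γ) {V : ι → Set X}
    (hV : ∀ i, IsOpen (V i)) : IsClosed (⋃ i, footprint (S i) (V i))ᶜ :=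
  (isOpen_iUnion fun i => isOpen_footprint (S i) (hV i)).isClosed_compl

/-- Castles for an almost finite action, with prescribed invariance of the nonempty shapes and a
remainder of small density. -/
theorem AlmostFinite.exists_castle (h : AlmostFinite Γ X) {p : Finset Γ → Prop}
    (hp : ∀ᶠ F in folner Γ, p F) {n : ℕ} (hn : 0 < n) {δ : ℝ} (hδ : 0 < δ) :
    ∃ (m : ℕ) (S : Fin m → Finset Γ) (V : Fin m → Set X),
      IsCastle S V ∧ (∀ i, IsOpen (V i)) ∧ (∀ i, (S i).Nonempty → p (S i)) ∧
      (∀ i, ∀ s ∈ S i, Metric.diam (s • V i) < δ) ∧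
      UpperDensityLE Γ (ind (⋃ i, footprint (S i) (V i))ᶜ) (1 / n) ∧
      ∃ S' : Fin m → Finset Γ, (∀ i, S' i ⊆ S i) ∧
        (∀ i, ((S' i).card : ℝ) ≤ ((S i).card : ℝ) / (n : ℝ)) ∧
        Subequiv Γ (⋃ i, footprint (S i) (V i))ᶜ (⋃ i, footprint (S' i) (V i)) := by
  obtain ⟨K, δ', hδ', hK⟩ := eventually_folner.1 hp
  obtain ⟨m, S, V, hc, hV, hS, hdiam, S', hS', hcard, hsub⟩ := h n hn K (min δ δ') (lt_min hδ hδ')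
  refine ⟨m, S, V, hc, hV, fun i hi => hK _ hi ((hS i).mono le_rfl (min_le_right _ _)),
    fun i s hs => (hdiam i s hs).trans_le (min_le_left _ _), ?_, S', hS', hcard, hsub⟩
  refine hsub.upperDensityLE (isClosed_remainder S hV) ?_
  -- The levels indexed by `S'` have at most `1 / n` times the density of all levels, hence density
  -- at most `1 / n`; the remainder is subequivalent to them.
  have h1 := UpperDensityLE.of_card_le S' S (1 / n) V (fun i => by
    rw [one_div, inv_mul_eq_div]; exact hcard i)
  refine (h1.add (UpperDensityLE.of_le Γ (f := fun x => (1 / n : ℝ) *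
    ∑ i, ∑ s ∈ S i, ind (s • V i) x) (c := 1 / n) fun x => ?_)).mono (fun x => ?_) (by simp)
  · rw [hc.sum_ind]
    exact mul_le_of_le_one_right (by positivity) (ind_le_one _ _)
  · rw [(hc.mono hS' fun i => le_rfl).sum_ind]
    linarith

end AlmostFinite

/-! ### Sets with boundary of density zero -/

section NullFrontier

variable {Γ : Type*} [Group Γ]

theorem upperDensityLE_ind_union {X : Type*} [MulAction Γ X] {A B : Set X} (hA : UpperDensityLE Γ (ind A) 0)
    (hB : UpperDensityLE Γ (ind B) 0) : UpperDensityLE Γ (ind (A ∪ B)) 0 := by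
  refine (hA.add hB).mono (fun x => ?_) (by simp)
  rcases em (x ∈ A) with h | h <;> rcases em (x ∈ B) with h' | h' <;>
    simp [ind, h, h']

variable {X : Type*} [MetricSpace X] [MulAction Γ X]

variable (Γ) in
/-- Sets whose boundary has density zero. -/
def NullFrontier (A : Set X) : Prop := UpperDensityLE Γ (ind (frontier A)) 0

theorem nullFrontier_of_subset {A B : Set X} (hB : UpperDensityLE Γ (ind B) 0)
    (h : frontier A ⊆ B) : NullFrontier Γ A := hB.mono (ind_mono h) le_rfl

theorem NullFrontier.inter {A B : Set X} (hA : NullFrontier Γ A) (hB : NullFrontier Γ B) :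
    NullFrontier Γ (A ∩ B) := by
  refine nullFrontier_of_subset (upperDensityLE_ind_union hA hB) ?_
  exact (frontier_inter_subset A B).trans
    (Set.union_subset_union Set.inter_subset_left Set.inter_subset_right)

theorem NullFrontier.compl {A : Set X} (hA : NullFrontier Γ A) : NullFrontier Γ Aᶜ := by
  unfold NullFrontier
  rwa [frontier_compl]

theorem NullFrontier.union {A B : Set X} (hA : NullFrontier Γ A) (hB : NullFrontier Γ B) :
    NullFrontier Γ (A ∪ B) := by
  have := (hA.compl.inter hB.compl).compl
  rwa [Set.compl_inter, compl_compl, compl_compl] at this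

theorem nullFrontier_empty : NullFrontier Γ (∅ : Set X) :=
  UpperDensityLE.of_le Γ fun x => by simp [ind]

theorem nullFrontier_univ : NullFrontier Γ (Set.univ : Set X) :=
  UpperDensityLE.of_le Γ fun x => by simp [ind]

theorem NullFrontier.biUnion {κ : Type*} (I : Finset κ) {A : κ → Set X}
    (h : ∀ i ∈ I, NullFrontier Γ (A i)) : NullFrontier Γ (⋃ i ∈ I, A i) := by
  induction I using Finset.induction_on with
  | empty => simpa using nullFrontier_empty
  | insert a s ha ih =>
    rw [Finset.set_biUnion_insert]
    exact (h a (by simp)).union (ih fun i hi => h i (by simp [hi]))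

theorem NullFrontier.biInter {κ : Type*} (I : Finset κ) {A : κ → Set X}
    (h : ∀ i ∈ I, NullFrontier Γ (A i)) : NullFrontier Γ (⋂ i ∈ I, A i) := by
  induction I using Finset.induction_on with
  | empty => simpa using nullFrontier_univ
  | insert a s ha ih =>
    rw [Finset.set_biInter_insert]
    exact (h a (by simp)).inter (ih fun i hi => h i (by simp [hi]))

theorem NullFrontier.smul [ContinuousConstSMul Γ X] {A : Set X} (hA : NullFrontier Γ A) (s : Γ) :
    NullFrontier Γ (s • A) := by
  have h : frontier (s • A) = s • frontier A := by
    rw [frontier, frontier, closure_smul, interior_smul, Set.smul_set_sdiff]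
  unfold NullFrontier
  rw [h]
  refine (hA.comp_smul (abs_ind_le_one _) s⁻¹).mono (fun x => (ind_smul s _ x).le) le_rfl

end NullFrontier

/-! ### The small boundary property -/

section SmallBoundary

open Filter Topology Metric

variable {Γ : Type*} [Group Γ] {X : Type*} [MetricSpace X] [CompactSpace X] [MulAction Γ X]
  [ContinuousConstSMul Γ X]

/-- The two sets can be separated up to a set of small density. -/
theorem AlmostFinite.exists_separation (h : AlmostFinite Γ X) [Nonempty X] {A U : Set X}
    (hA : IsClosed A) (hU : IsOpen U) (hAU : A ⊆ U) {ε : ℝ} (hε : 0 < ε) :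
    ∃ A' U' : Set X, IsClosed A' ∧ IsOpen U' ∧ A ⊆ A' ∧ A' ⊆ U' ∧ U' ⊆ U ∧
      UpperDensityLE Γ (ind (U' \ A')) ε := by
  have := h.neBot_folner
  obtain ⟨δ, hδ, hδU⟩ := hA.isCompact.exists_thickening_subset_open hU hAU
  obtain ⟨n, hn⟩ := exists_nat_one_div_lt hε
  obtain ⟨m, S, V, hc, hV, -, hdiam, hdens, -⟩ := h.exists_castle (p := fun _ => True)
    (Filter.Eventually.of_forall fun _ => trivial) n.succ_pos hδ
  set R := (⋃ i, footprint (S i) (V i))ᶜ with hR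
  obtain ⟨r, hr, hrdens⟩ := eventually_nhdsGT_of_nhds
    (hdens.eventually_cthickening_ind (isClosed_remainder S hV) (by push_cast; exact hn))
  -- `W` is an open neighbourhood of the remainder, still of small density; `Y` and `Z` collect the
  -- levels that meet `A` and those that miss it.
  set W := thickening r R
  have hRW : R ⊆ W := self_subset_thickening hr R
  have hWd : UpperDensityLE Γ (ind W) ε :=
    hrdens.mono (ind_mono (thickening_subset_cthickening r R)) le_rfl
  set P : Fin m → Γ → Prop := fun i s => s ∈ S i ∧ (s • V i ∩ A).Nonempty
  set Q : Fin m → Γ → Prop := fun i s => s ∈ S i ∧ ¬ (s • V i ∩ A).Nonempty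
  set Y := ⋃ i, ⋃ s, ⋃ _ : P i s, s • V i with hY
  set Z := ⋃ i, ⋃ s, ⋃ _ : Q i s, s • V i with hZ
  have hYo : IsOpen Y :=
    isOpen_iUnion fun i => isOpen_iUnion fun s => isOpen_iUnion fun _ => (hV i).smul s
  have hZo : IsOpen Z :=
    isOpen_iUnion fun i => isOpen_iUnion fun s => isOpen_iUnion fun _ => (hV i).smul s
  have hcov : ∀ x, x ∈ W ∨ x ∈ Y ∨ x ∈ Z := by
    intro x
    by_cases hx : x ∈ R
    · exact Or.inl (hRW hx)
    · rw [hR, Set.notMem_compl_iff] at hx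
      obtain ⟨i, hi⟩ := Set.mem_iUnion.1 hx
      obtain ⟨s, hs, hxs⟩ := mem_footprint.1 hi
      by_cases hn : (s • V i ∩ A).Nonempty
      · exact Or.inr (Or.inl (by simp only [hY, Set.mem_iUnion]; exact ⟨i, s, ⟨hs, hn⟩, hxs⟩))
      · exact Or.inr (Or.inr (by simp only [hZ, Set.mem_iUnion]; exact ⟨i, s, ⟨hs, hn⟩, hxs⟩))
  have hYZ : Disjoint Y Z := by
    simp only [hY, hZ, Set.disjoint_iUnion_left, Set.disjoint_iUnion_right]
    intro j t ht i s hs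
    refine hc.disjoint_levels hs.1 ht.1 fun he => ht.2 ?_
    cases he
    exact hs.2
  have hYU : Y ⊆ U := by
    intro x hx
    simp only [hY, Set.mem_iUnion] at hx
    obtain ⟨i, s, ⟨hs, y, hy, hyA⟩, hxs⟩ := hx
    refine hδU (mem_thickening_iff.2 ⟨y, hyA, ?_⟩)
    exact (dist_le_diam_of_mem isBounded_of_compactSpace hxs hy).trans_lt (hdiam i s hs)
  have hAZ : Disjoint A Z := by
    simp only [hZ, Set.disjoint_iUnion_right]
    intro i s hs
    rw [disjoint_comm, Set.disjoint_iff_inter_eq_empty]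
    exact Set.not_nonempty_iff_eq_empty.1 hs.2
  -- Levels meeting `A` have diameter below `δ` and so stay in `U`. Outside `W` the sets `Y` and `Z`
  -- partition the space, so the two witnesses differ only inside `W`.
  refine ⟨A ∪ (W ∪ Z)ᶜ, U ∩ (Y ∪ W), hA.union (isOpen_thickening.union hZo).isClosed_compl,
    hU.inter (hYo.union isOpen_thickening), Set.subset_union_left, ?_, Set.inter_subset_left,
    hWd.mono (ind_mono ?_) le_rfl⟩
  · rintro x (hx | hx)
    · refine ⟨hAU hx, ?_⟩
      rcases hcov x with h | h | h
      · exact Or.inr h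
      · exact Or.inl h
      · exact (Set.disjoint_left.1 hAZ hx h).elim
    · rw [Set.mem_compl_iff, Set.mem_union, not_or] at hx
      have hxY : x ∈ Y := by
        rcases hcov x with h | h | h
        · exact (hx.1 h).elim
        · exact h
        · exact (hx.2 h).elim
      exact ⟨hYU hxY, Or.inl hxY⟩
  · rintro x ⟨⟨-, hx | hx⟩, hx'⟩
    · by_contra hxW
      refine hx' (Or.inr ?_)
      rw [Set.mem_compl_iff, Set.mem_union, not_or]
      exact ⟨hxW, Set.disjoint_left.1 hYZ hx⟩
    · exact hx

/-- An almost finite action has the small boundary property. -/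
theorem AlmostFinite.exists_nullFrontier (h : AlmostFinite Γ X) [Nonempty X] {A U : Set X}
    (hA : IsClosed A) (hU : IsOpen U) (hAU : A ⊆ U) :
    ∃ O : Set X, IsOpen O ∧ A ⊆ O ∧ O ⊆ U ∧ NullFrontier Γ O := by
  -- Iterated separation produces closed sets increasing into interiors and open sets decreasing
  -- with closures. The union of the closed sets is open, and its boundary lies in every gap, whose
  -- density tends to zero. The extra sets `Y₁` and `Y₂` provide the interior and closure
  -- conditions.
  have step : ∀ (n : ℕ) (p : {p : Set X × Set X // IsClosed p.1 ∧ IsOpen p.2 ∧ p.1 ⊆ p.2}),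
      ∃ q : {p : Set X × Set X // IsClosed p.1 ∧ IsOpen p.2 ∧ p.1 ⊆ p.2},
        p.1.1 ⊆ interior q.1.1 ∧ closure q.1.2 ⊆ p.1.2 ∧
        UpperDensityLE Γ (ind (q.1.2 \ q.1.1)) (1 / (n + 1)) := by
    rintro n ⟨⟨B, Y⟩, hB, hY, hBY⟩
    obtain ⟨Y₁, hY₁, hBY₁, hY₁Y⟩ := normal_exists_closure_subset hB hY hBY
    obtain ⟨Y₂, hY₂, hY₁Y₂, hY₂Y⟩ := normal_exists_closure_subset isClosed_closure hY hY₁Y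
    obtain ⟨A', U', hA', hU', h1, h2, h3, h4⟩ := h.exists_separation isClosed_closure hY₂ hY₁Y₂
      (ε := 1 / (n + 1)) (by positivity)
    refine ⟨⟨(A', U'), hA', hU', h2⟩, ?_, (closure_mono h3).trans hY₂Y, h4⟩
    exact hBY₁.trans (interior_maximal (subset_closure.trans h1) hY₁)
  choose next hnext using step
  let p : ℕ → {p : Set X × Set X // IsClosed p.1 ∧ IsOpen p.2 ∧ p.1 ⊆ p.2} := fun n =>
    Nat.rec ⟨(A, U), hA, hU, hAU⟩ (fun n q => next n q) n
  have hp : ∀ n, p (n + 1) = next n (p n) := fun n => rfl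
  have hA1 : ∀ n, (p n).1.1 ⊆ interior (p (n + 1)).1.1 := fun n => (hnext n (p n)).1
  have hU1 : ∀ n, closure (p (n + 1)).1.2 ⊆ (p n).1.2 := fun n => (hnext n (p n)).2.1
  have hd : ∀ n : ℕ, UpperDensityLE Γ (ind ((p (n + 1)).1.2 \ (p (n + 1)).1.1))
      (1 / ((n : ℝ) + 1)) := fun n => (hnext n (p n)).2.2
  have hAmono : Monotone fun n => (p n).1.1 :=
    monotone_nat_of_le_succ fun n => (hA1 n).trans interior_subset
  have hUanti : Antitone fun n => (p n).1.2 :=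
    antitone_nat_of_succ_le fun n => subset_closure.trans (hU1 n)
  set O := ⋃ n, (p n).1.1 with hO
  have hOU : ∀ n, O ⊆ (p n).1.2 := by
    intro n x hx
    obtain ⟨k, hk⟩ := Set.mem_iUnion.1 hx
    have h1 := hAmono (le_max_left k n) hk
    exact hUanti (le_max_right k n) ((p (max k n)).2.2.2 h1)
  have hOopen : IsOpen O := by
    have : O = ⋃ n, interior (p n).1.1 := by
      refine Set.Subset.antisymm (Set.iUnion_subset fun n => ?_)
        (Set.iUnion_mono fun n => interior_subset)
      exact (hA1 n).trans (Set.subset_iUnion (fun n => interior (p n).1.1) (n + 1))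
    rw [this]
    exact isOpen_iUnion fun n => isOpen_interior
  refine ⟨O, hOopen, Set.subset_iUnion (fun n => (p n).1.1) 0, hOU 0, ?_⟩
  refine UpperDensityLE.of_forall_lt fun c hc => ?_
  obtain ⟨n, hn⟩ := exists_nat_one_div_lt hc
  refine (hd n).mono (ind_mono ?_) hn.le
  rw [hOopen.frontier_eq]
  rintro x ⟨hx, hx'⟩
  refine ⟨hU1 (n + 1) (closure_mono (hOU (n + 2)) hx), fun h => hx' ?_⟩
  exact Set.mem_iUnion.2 ⟨n + 1, h⟩

end SmallBoundary

/-! ### Cutting sets into pieces of equal density -/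

section Splitting

open Filter Topology Metric

/-- A finite set can be cut into `N` parts of almost equal size. -/
theorem exists_balanced {α : Type*} (P : Finset α) {N : ℕ} (hN : 0 < N) :
    ∃ f : α → Fin N, ∀ j, ((P.filter fun s => f s = j).card : ℝ) ≤ P.card / N + 1 ∧
      (P.card : ℝ) / N - 1 ≤ (P.filter fun s => f s = j).card := by
  have hN' : (0 : ℝ) < N := Nat.cast_pos.2 hN
  -- Colour the elements cyclically in the order in which they are added.
  have h : ∃ f : α → Fin N, ∀ j, (P.filter fun s => f s = j).card =
      ((Finset.range P.card).filter fun k => k % N = j).card := by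
    induction P using Finset.induction_on with
    | empty => exact ⟨fun _ => ⟨0, hN⟩, fun j => by simp⟩
    | insert a P ha ih =>
      obtain ⟨f, hf⟩ := ih
      refine ⟨Function.update f a ⟨P.card % N, Nat.mod_lt _ hN⟩, fun j => ?_⟩
      rw [Finset.card_insert_of_notMem ha, Finset.range_add_one, Finset.filter_insert,
        Finset.filter_insert]
      have h1 : P.filter (fun s => Function.update f a ⟨P.card % N, Nat.mod_lt _ hN⟩ s = j) =
          P.filter fun s => f s = j := by
        refine Finset.filter_congr fun s hs => ?_
        rw [Function.update_of_ne (by rintro rfl; exact ha hs)]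
      have h2 : (Function.update f a ⟨P.card % N, Nat.mod_lt _ hN⟩ a = j) ↔ P.card % N = j := by
        rw [Function.update_self, Fin.ext_iff]
      rw [h1]
      by_cases h3 : P.card % N = j
      · rw [if_pos (h2.2 h3), if_pos h3, Finset.card_insert_of_notMem (by simp [ha]),
          Finset.card_insert_of_notMem (by simp), hf]
      · rw [if_neg (fun h => h3 (h2.1 h)), if_neg h3, hf]
  obtain ⟨f, hf⟩ := h
  refine ⟨f, fun j => ?_⟩
  have h1 : (P.filter fun s => f s = j).card = P.card / N + if j % N < P.card % N then 1 else 0 := by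
    rw [hf, ← Nat.count_modEq_card _ hN, Nat.count_eq_card_filter_range]
    congr 1
    refine Finset.filter_congr fun k _ => ?_
    rw [Nat.ModEq, Nat.mod_eq_of_lt j.2]
  have h2 : (P.card : ℝ) = N * ((P.card / N : ℕ) : ℝ) + ((P.card % N : ℕ) : ℝ) := by
    exact_mod_cast (Nat.div_add_mod P.card N).symm
  have h3 : ((P.card % N : ℕ) : ℝ) ≤ N := by exact_mod_cast (Nat.mod_lt _ hN).le
  have h4 : (0 : ℝ) ≤ ((P.card % N : ℕ) : ℝ) := Nat.cast_nonneg _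
  have h5 : (P.card : ℝ) / N = ((P.card / N : ℕ) : ℝ) + ((P.card % N : ℕ) : ℝ) / N := by
    rw [h2]; field_simp
  have h6 : ((P.card % N : ℕ) : ℝ) / N ≤ 1 := by rwa [div_le_one hN']
  have h7 : 0 ≤ ((P.card % N : ℕ) : ℝ) / N := by positivity
  rw [h1, h5]
  push_cast
  split_ifs <;> constructor <;> linarith

variable {Γ : Type*} [Group Γ] {X : Type*} [MetricSpace X] [CompactSpace X] [MulAction Γ X]
  [ContinuousConstSMul Γ X]

/-- For an almost finite action of an infinite group, a closed set and an open set can be cut into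
`N` pieces in such a way that the differences of densities are equally distributed. -/
theorem AlmostFinite.exists_split [Infinite Γ] (h : AlmostFinite Γ X) [Nonempty X] {A B : Set X}
    (hA : IsClosed A) {N : ℕ} (hN : 0 < N) {η δ : ℝ} (hη : 0 < η) (hδ : 0 < δ) :
    ∃ A' B' : Fin N → Set X, (∀ j, IsClosed (A' j)) ∧ A ⊆ ⋃ j, A' j ∧ (∀ j, IsOpen (B' j)) ∧
      (∀ i j, i ≠ j → Disjoint (B' i) (B' j)) ∧ (∀ j, B' j ⊆ B) ∧
      ∀ j, UpperDensityLE Γ (fun x => ind (A' j) x - ind (B' j) x -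
        (1 / N : ℝ) * (ind (cthickening δ A) x + ind (cthickening δ Bᶜ) x - 1)) η := by
  have := h.neBot_folner
  have hN' : (0 : ℝ) < N := Nat.cast_pos.2 hN
  have hN1 : (1 / N : ℝ) ≤ 1 := by
    rw [div_le_one hN']
    exact_mod_cast hN
  have hN0 : (0 : ℝ) ≤ 1 / N := by positivity
  obtain ⟨n, hn⟩ := exists_nat_one_div_lt (show 0 < η / 4 by positivity)
  obtain ⟨M, hM⟩ := exists_nat_one_div_lt (show 0 < η / 4 by positivity)
  obtain ⟨m, S, V, hc, hV, hS, hdiam, hdens, -⟩ := h.exists_castle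
    (eventually_le_card (Γ := Γ) (M + 1)) n.succ_pos hδ
  push_cast at hdens
  set R := (⋃ i, footprint (S i) (V i))ᶜ with hR
  obtain ⟨r, hr, hrdens⟩ := eventually_nhdsGT_of_nhds
    (hdens.eventually_cthickening_ind (isClosed_remainder S hV) hn)
  set C := cthickening r R
  have hRC : R ⊆ C := self_subset_cthickening R
  set P : Fin m → Finset Γ := fun i => (S i).filter fun s => (s • V i ∩ A).Nonempty
  set Q : Fin m → Finset Γ := fun i => (S i).filter fun s => s • V i ⊆ B
  choose f hf using fun i => exists_balanced (P i) hN
  choose g hg using fun i => exists_balanced (Q i) hN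
  set Pj : Fin N → Fin m → Finset Γ := fun j i => (P i).filter fun s => f i s = j with hPj
  set Qj : Fin N → Fin m → Finset Γ := fun j i => (Q i).filter fun s => g i s = j with hQj
  have hPS : ∀ i, P i ⊆ S i := fun i => Finset.filter_subset _ _
  have hQS : ∀ i, Q i ⊆ S i := fun i => Finset.filter_subset _ _
  have hPjP : ∀ j i, Pj j i ⊆ P i := fun j i => Finset.filter_subset _ _
  have hQjQ : ∀ j i, Qj j i ⊆ Q i := fun j i => Finset.filter_subset _ _
  have hlevel : ∀ x, x ∉ R → ∃ i, ∃ s ∈ S i, x ∈ s • V i := by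
    intro x hx
    rw [hR, Set.notMem_compl_iff] at hx
    obtain ⟨i, hi⟩ := Set.mem_iUnion.1 hx
    exact ⟨i, mem_footprint.1 hi⟩
  have hclose : ∀ i, ∀ s ∈ S i, ∀ x ∈ s • V i, ∀ y ∈ s • V i, dist x y ≤ δ := fun i s hs x hx y hy =>
    (dist_le_diam_of_mem isBounded_of_compactSpace hx hy).trans (hdiam i s hs).le
  have hopen : ∀ T : Fin m → Finset Γ, IsOpen (⋃ i, footprint (T i) (V i)) := fun T =>
    isOpen_iUnion fun i => isOpen_footprint (T i) (hV i)
  -- To keep the `j`-th piece of `A` closed, remove the open levels not assigned to `j`, but nothing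
  -- inside the closed neighbourhood `C` of the remainder. Each piece thus contains all of `A ∩ C`,
  -- whose density is small.
  refine ⟨fun j => A \ ((⋃ i, footprint (S i \ Pj j i) (V i)) \ C),
    fun j => ⋃ i, footprint (Qj j i) (V i), fun j => ?_, ?_, fun j => hopen _, ?_, ?_, ?_⟩
  · exact hA.sdiff ((hopen _).sdiff isClosed_cthickening)
  · intro x hx
    rw [Set.mem_iUnion]
    by_cases hxR : x ∈ R
    · exact ⟨⟨0, hN⟩, hx, fun h => h.2 (hRC hxR)⟩
    · obtain ⟨i, s, hs, hxs⟩ := hlevel x hxR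
      refine ⟨f i s, hx, fun h => ?_⟩
      obtain ⟨i', hi'⟩ := Set.mem_iUnion.1 h.1
      obtain ⟨s', hs', hxs'⟩ := mem_footprint.1 hi'
      rw [Finset.mem_sdiff] at hs'
      by_cases he : (i, s) = (i', s')
      · cases he
        refine hs'.2 (Finset.mem_filter.2 ⟨Finset.mem_filter.2 ⟨hs, x, hxs, hx⟩, rfl⟩)
      · exact Set.disjoint_left.1 (hc.disjoint_levels hs hs'.1 he) hxs hxs'
  · intro j j' hjj
    rw [Set.disjoint_left]
    intro x hx hx'
    obtain ⟨i, hi⟩ := Set.mem_iUnion.1 hx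
    obtain ⟨s, hs, hxs⟩ := mem_footprint.1 hi
    obtain ⟨i', hi'⟩ := Set.mem_iUnion.1 hx'
    obtain ⟨s', hs', hxs'⟩ := mem_footprint.1 hi'
    by_cases he : (i, s) = (i', s')
    · cases he
      exact hjj ((Finset.mem_filter.1 hs).2.symm.trans (Finset.mem_filter.1 hs').2)
    · exact Set.disjoint_left.1 (hc.disjoint_levels (hQS _ (hQjQ _ _ hs)) (hQS _ (hQjQ _ _ hs')) he)
        hxs hxs'
  · intro j x hx
    obtain ⟨i, hi⟩ := Set.mem_iUnion.1 hx
    obtain ⟨s, hs, hxs⟩ := mem_footprint.1 hi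
    exact (Finset.mem_filter.1 (hQjQ _ _ hs)).2 hxs
  · intro j
    have h1 : ∀ x, ind (A \ ((⋃ i, footprint (S i \ Pj j i) (V i)) \ C)) x ≤
        ind C x + ∑ i, ∑ s ∈ Pj j i, ind (s • V i) x := by
      intro x
      rw [(hc.mono (fun i => (hPjP j i).trans (hPS i)) fun i => le_rfl).sum_ind]
      by_cases hx : x ∈ A \ ((⋃ i, footprint (S i \ Pj j i) (V i)) \ C)
      · by_cases hxC : x ∈ C
        · linarith [ind_le_one (A \ ((⋃ i, footprint (S i \ Pj j i) (V i)) \ C)) x, ind_of_mem hxC,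
            ind_nonneg (⋃ i, footprint (Pj j i) (V i)) x]
        · have hx2 : x ∈ ⋃ i, footprint (Pj j i) (V i) := by
            obtain ⟨i, s, hs, hxs⟩ := hlevel x fun hxR => hxC (hRC hxR)
            refine Set.mem_iUnion.2 ⟨i, mem_footprint.2 ⟨s, ?_, hxs⟩⟩
            by_contra hsn
            exact hx.2 ⟨Set.mem_iUnion.2 ⟨i, mem_footprint.2
              ⟨s, Finset.mem_sdiff.2 ⟨hs, hsn⟩, hxs⟩⟩, hxC⟩
          rw [ind_of_mem hx, ind_of_mem hx2]
          linarith [ind_nonneg C x]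
      · rw [ind_of_notMem hx]
        linarith [ind_nonneg C x, ind_nonneg (⋃ i, footprint (Pj j i) (V i)) x]
    have h2 : ∀ x, ∑ i, ∑ s ∈ P i, ind (s • V i) x ≤ ind (cthickening δ A) x := by
      intro x
      rw [(hc.mono hPS fun i => le_rfl).sum_ind]
      refine ind_mono ?_ x
      intro y hy
      obtain ⟨i, hi⟩ := Set.mem_iUnion.1 hy
      obtain ⟨s, hs, hys⟩ := mem_footprint.1 hi
      obtain ⟨hs, z, hz, hzA⟩ := Finset.mem_filter.1 hs
      exact mem_cthickening_of_dist_le y z δ A hzA (hclose i s hs y hys z hz)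
    have h3 : ∀ x, 1 - ind (cthickening δ Bᶜ) x ≤ ∑ i, ∑ s ∈ Q i, ind (s • V i) x + ind C x := by
      intro x
      rw [(hc.mono hQS fun i => le_rfl).sum_ind]
      by_cases hx : x ∈ cthickening δ Bᶜ
      · rw [ind_of_mem hx]
        linarith [ind_nonneg C x, ind_nonneg (⋃ i, footprint (Q i) (V i)) x]
      rw [ind_of_notMem hx]
      by_cases hxC : x ∈ C
      · linarith [ind_of_mem hxC, ind_nonneg (⋃ i, footprint (Q i) (V i)) x]
      · obtain ⟨i, s, hs, hxs⟩ := hlevel x fun hxR => hxC (hRC hxR)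
        have hx2 : x ∈ ⋃ i, footprint (Q i) (V i) := by
          refine Set.mem_iUnion.2 ⟨i, mem_footprint.2 ⟨s, Finset.mem_filter.2 ⟨hs, ?_⟩, hxs⟩⟩
          intro y hy
          by_contra hyB
          exact hx (mem_cthickening_of_dist_le x y δ Bᶜ hyB (hclose i s hs x hxs y hy))
        rw [ind_of_mem hx2]
        linarith [ind_nonneg C x]
    have h4 : ∀ x, ∑ i, ∑ s ∈ S i, ind (s • V i) x ≤ 1 := fun x => by
      rw [hc.sum_ind]; exact ind_le_one _ _
    -- Balancing is exact up to one level for `A` and one for `B` in each column. As nonempty shapes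
    -- have at least `M + 1` elements, the weight `2 / (M + 1)` per level absorbs both errors. This
    -- and the two uses of `C` add up to at most `η`.
    have hw := UpperDensityLE.of_weights Finset.univ S (fun i s => (if s ∈ Pj j i then 1 else 0) -
      (if s ∈ Qj j i then 1 else 0) - (1 / N : ℝ) * (if s ∈ P i then 1 else 0) +
      (1 / N : ℝ) * (if s ∈ Q i then 1 else 0) - 2 * (1 / (M + 1) : ℝ)) V (fun i _ => by
        rw [Finset.sum_sub_distrib, Finset.sum_add_distrib, Finset.sum_sub_distrib,
          Finset.sum_sub_distrib, ← Finset.mul_sum, ← Finset.mul_sum]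
        simp only [Finset.sum_ite_mem, Finset.inter_eq_right.2 (hPS i),
          Finset.inter_eq_right.2 (hQS i), Finset.inter_eq_right.2 ((hPjP j i).trans (hPS i)),
          Finset.inter_eq_right.2 ((hQjQ j i).trans (hQS i)), Finset.sum_const, nsmul_eq_mul,
          mul_one]
        rcases (S i).eq_empty_or_nonempty with he | hne
        · have e1 : P i = ∅ := Finset.subset_empty.1 (he ▸ hPS i)
          have e2 : Q i = ∅ := Finset.subset_empty.1 (he ▸ hQS i)
          have e3 : Pj j i = ∅ := Finset.subset_empty.1 (e1 ▸ hPjP j i)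
          have e4 : Qj j i = ∅ := Finset.subset_empty.1 (e2 ▸ hQjQ j i)
          simp [e1, e2, e3, e4, he]
        · have b1 := (hf i j).1
          have b2 := (hg i j).2
          have b3 : (1 : ℝ) ≤ (S i).card * (1 / (M + 1)) := by
            rw [mul_one_div, le_div_iff₀ (by positivity), one_mul]
            exact_mod_cast hS i hne
          have b1' : ((Pj j i).card : ℝ) ≤ (P i).card / N + 1 := b1
          have b2' : ((Q i).card : ℝ) / N - 1 ≤ (Qj j i).card := b2
          rw [one_div, inv_mul_eq_div, inv_mul_eq_div]
          linarith)
    refine ((hw.add ((hrdens.add hrdens).add (UpperDensityLE.of_le Γ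
      (f := fun x => 2 * (1 / (M + 1) : ℝ) * ∑ i, ∑ s ∈ S i, ind (s • V i) x)
      (c := 2 * (1 / (M + 1) : ℝ)) fun x => mul_le_of_le_one_right (by positivity)
        (h4 x)))).mono (fun x => ?_) (by linarith))
    have e : ∑ i, ∑ s ∈ S i, ((if s ∈ Pj j i then 1 else 0) -
      (if s ∈ Qj j i then 1 else 0) - (1 / N : ℝ) * (if s ∈ P i then 1 else 0) +
      (1 / N : ℝ) * (if s ∈ Q i then 1 else 0) - 2 * (1 / (M + 1) : ℝ)) * ind (s • V i) x =
      ∑ i, ∑ s ∈ Pj j i, ind (s • V i) x - ∑ i, ∑ s ∈ Qj j i, ind (s • V i) x -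
      (1 / N : ℝ) * ∑ i, ∑ s ∈ P i, ind (s • V i) x + (1 / N : ℝ) * ∑ i, ∑ s ∈ Q i, ind (s • V i) x
      - 2 * (1 / (M + 1) : ℝ) * ∑ i, ∑ s ∈ S i, ind (s • V i) x := by
      simp only [Finset.mul_sum, ← Finset.sum_sub_distrib, ← Finset.sum_add_distrib]
      refine Finset.sum_congr rfl fun i _ => ?_
      simp only [sub_mul, add_mul, ite_mul, one_mul, zero_mul, mul_assoc, Finset.sum_sub_distrib,
        Finset.sum_add_distrib, ← Finset.mul_sum, Finset.sum_ite_mem,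
        Finset.inter_eq_right.2 (hPS i), Finset.inter_eq_right.2 (hQS i),
        Finset.inter_eq_right.2 ((hPjP j i).trans (hPS i)),
        Finset.inter_eq_right.2 ((hQjQ j i).trans (hQS i))]
    rw [e, ← (hc.mono (fun i => (hQjQ j i).trans (hQS i)) fun i => le_rfl).sum_ind x]
    have k1 := mul_le_mul_of_nonneg_left (h2 x) hN0
    have k2 := mul_le_mul_of_nonneg_left (h3 x) hN0
    have k3 := mul_le_mul_of_nonneg_right hN1 (ind_nonneg C x)
    linarith [h1 x]

end Splitting

/-! ### Comparison from almost finiteness of a subgroup -/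

section Comparison

open Filter Topology Metric

variable {G : Type*} [Group G] {X : Type*} [MetricSpace X] [CompactSpace X] [MulAction G X]
  [ContinuousConstSMul G X] {H : Subgroup G}

instance continuousConstSMul_subgroup {G X : Type*} [Group G] [TopologicalSpace X] [MulAction G X]
    [ContinuousConstSMul G X] (H : Subgroup G) : ContinuousConstSMul H X :=
  ⟨fun h => continuous_const_smul (h : G)⟩

/-- Comparison for finitely many sets moved by elements of a larger group, from almost finiteness
of the action of a subgroup. -/
theorem AlmostFinite.subequiv_of_upperDensityLE (hH : AlmostFinite H X) [Nonempty X]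
    {J : Type} [Fintype J] {A B : J → Set X} (hA : ∀ j, IsClosed (A j)) (hB : ∀ j, IsOpen (B j))
    (hdisj : ∀ i j, i ≠ j → Disjoint (B i) (B j)) (β : J → G) {c : ℝ} (hc : c < 0)
    (h : UpperDensityLE H (fun x => ∑ j, (ind (A j) (β j • x) - ind (B j) (β j • x))) c) :
    Subequiv G (⋃ j, A j) (⋃ j, B j) := by
  have := hH.neBot_folner
  set At : J → Set X := fun j => (β j)⁻¹ • A j with hAt
  set Bt : J → Set X := fun j => (β j)⁻¹ • B j with hBt
  have hmAt : ∀ j x, x ∈ At j ↔ β j • x ∈ A j := fun j x => by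
    rw [hAt, Set.mem_smul_set_iff_inv_smul_mem, inv_inv]
  have hmBt : ∀ j x, x ∈ Bt j ↔ β j • x ∈ B j := fun j x => by
    rw [hBt, Set.mem_smul_set_iff_inv_smul_mem, inv_inv]
  have hAtc : ∀ j, IsClosed (At j) := fun j => (hA j).smul _
  have hBto : ∀ j, IsOpen (Bt j) := fun j => (hB j).smul _
  -- Trading `-ind (B j)` for the indicator of the closed complement, at the price of the constant
  -- `|J|`, makes the function upper semicontinuous, so the sets can be thickened.
  have h1 : UpperDensityLE H (fun x => ∑ k : J ⊕ J,
      ind (Sum.elim At (fun j => (Bt j)ᶜ) k) x) (c + Fintype.card J) := by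
    refine (h.add (UpperDensityLE.of_le H (f := fun _ => (Fintype.card J : ℝ))
      fun _ => le_rfl)).mono (fun x => le_of_eq ?_) le_rfl
    rw [Fintype.sum_sum_type, ← Finset.card_univ, ← nsmul_one (Finset.univ.card : ℕ),
      ← Finset.sum_const, ← Finset.sum_add_distrib, ← Finset.sum_add_distrib]
    refine Finset.sum_congr rfl fun j _ => ?_
    simp only [Sum.elim_inl, Sum.elim_inr, ind_compl]
    rw [hAt, hBt, ind_smul, ind_smul, inv_inv]
    ring
  obtain ⟨δ, hδ, h2⟩ := eventually_nhdsGT_of_nhds (h1.eventually_cthickening Finset.univ _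
    (fun k => by rcases k with j | j <;> simp [hAtc, hBto]) (fun _ x => x) (fun _ => continuous_id)
    (show c + Fintype.card J < c / 2 + Fintype.card J by linarith))
  -- This `n` gives `|S'| * |J| ≤ -c / 4 * |S|`, exactly the surplus left by the averages.
  obtain ⟨n, hn⟩ := exists_nat_one_div_lt (show 0 < -c / (4 * (Fintype.card J + 1)) from
    div_pos (by linarith) (by positivity))
  obtain ⟨m, S, V, hcas, hV, hS, hdiam, -, S', hS', hcard, hsub⟩ := hH.exists_castle
    (h2 (-c / 4) (by linarith)) n.succ_pos hδ
  set a : Fin m → Finset (H × J) := fun i =>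
    (S i ×ˢ Finset.univ).filter fun q => (q.1 • V i ∩ At q.2).Nonempty with ha
  set b : Fin m → Finset (H × J) := fun i =>
    (S i ×ˢ Finset.univ).filter fun q => q.1 • V i ⊆ Bt q.2 with hb
  -- A single base point detects the whole column: levels have diameter below `δ`, so a level
  -- meeting `At j` has its representative in the thickening, and likewise for a level not contained
  -- in `Bt j`. The surplus of `b` over `a` leaves room for `|J|` copies of `S'`, which will receive
  -- the remainder.
  have hab : ∀ i, (a i).card + (S' i ×ˢ (Finset.univ : Finset J)).card ≤ (b i).card := by
    intro i
    rw [Finset.card_product, Finset.card_univ]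
    rcases (S i).eq_empty_or_nonempty with he | hne
    · have e1 : S' i = ∅ := Finset.subset_empty.1 (he ▸ hS' i)
      simp [ha, he, e1]
    rcases (V i).eq_empty_or_nonempty with he | ⟨x, hx⟩
    · have e1 : a i = ∅ := by simp [ha, he]
      have e2 : b i = S i ×ˢ Finset.univ := by simp [hb, he]
      rw [e1, e2, Finset.card_product, Finset.card_univ, Finset.card_empty, zero_add]
      exact Nat.mul_le_mul_right _ (Finset.card_le_card (hS' i))
    have hsum := hS i hne x
    simp only [Fintype.sum_sum_type, Sum.elim_inl, Sum.elim_inr, Finset.sum_add_distrib] at hsum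
    have hclose : ∀ s ∈ S i, ∀ y ∈ s • V i, dist (s • x) y ≤ δ := fun s hs y hy =>
      (dist_le_diam_of_mem isBounded_of_compactSpace (Set.smul_mem_smul_set hx) hy).trans
        (hdiam i s hs).le
    have k1 : ((a i).card : ℝ) ≤ ∑ s ∈ S i, ∑ j, ind (cthickening δ (At j)) (s • x) := by
      rw [← Finset.sum_product', ha, Finset.card_filter]
      push_cast
      refine Finset.sum_le_sum fun q hq => ?_
      split_ifs with hq'
      · obtain ⟨y, hy, hyA⟩ := hq'
        rw [ind_of_mem (mem_cthickening_of_dist_le _ y δ _ hyA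
          (hclose q.1 (Finset.mem_product.1 hq).1 y hy))]
      · exact ind_nonneg _ _
    have k2 : ((S i).card : ℝ) * Fintype.card J - (b i).card ≤
        ∑ s ∈ S i, ∑ j, ind (cthickening δ (Bt j)ᶜ) (s • x) := by
      rw [← Finset.sum_product', hb, Finset.card_filter, ← Finset.card_univ, ← Nat.cast_mul,
        ← Finset.card_product, Finset.card_eq_sum_ones]
      push_cast
      rw [← Finset.sum_sub_distrib]
      refine Finset.sum_le_sum fun q hq => ?_
      split_ifs with hq'
      · simpa using ind_nonneg _ _
      · obtain ⟨y, hy, hyB⟩ := Set.not_subset.1 hq'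
        rw [ind_of_mem (mem_cthickening_of_dist_le _ y δ _ hyB
          (hclose q.1 (Finset.mem_product.1 hq).1 y hy))]
        simp
    have k3 : ((S' i).card : ℝ) * Fintype.card J ≤ -c / 4 * (S i).card := by
      have hJ : (0 : ℝ) ≤ Fintype.card J := Nat.cast_nonneg _
      have hs0 : (0 : ℝ) ≤ (S i).card := Nat.cast_nonneg _
      have h3 := hcard i
      push_cast at h3
      calc ((S' i).card : ℝ) * Fintype.card J ≤ (S i).card / (n + 1) * Fintype.card J := by gcongr
        _ = 1 / (n + 1) * ((S i).card * Fintype.card J) := by ring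
        _ ≤ -c / (4 * (Fintype.card J + 1)) * ((S i).card * Fintype.card J) := by gcongr
        _ = -c / 4 * (S i).card * (Fintype.card J / (Fintype.card J + 1)) := by
            field_simp
        _ ≤ -c / 4 * (S i).card := by
            refine mul_le_of_le_one_right (mul_nonneg (by linarith) hs0) ?_
            rw [div_le_one (by positivity)]
            linarith
    have : ((a i).card : ℝ) + (S' i).card * Fintype.card J ≤ (b i).card := by nlinarith
    exact_mod_cast this
  have hψ : ∀ i, Nonempty ({q // q ∈ a i} ⊕ {q // q ∈ S' i ×ˢ (Finset.univ : Finset J)} ↪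
      {q // q ∈ b i}) := fun i => Function.Embedding.nonempty_of_card_le (by
    rw [Fintype.card_sum, Fintype.card_coe, Fintype.card_coe, Fintype.card_coe]; exact hab i)
  let ψ := fun i => Classical.choice (hψ i)
  obtain ⟨p, U, σ, hUo, hUcov, hUdisj, hUsub⟩ := hsub _ (isClosed_remainder S hV) le_rfl
  have hbmem : ∀ i (q : {q // q ∈ b i}), q.1.1 ∈ S i ∧ q.1.1 • V i ⊆ Bt q.1.2 := fun i q => by
    have := Finset.mem_filter.1 q.2
    exact ⟨(Finset.mem_product.1 this.1).1, this.2⟩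
  refine Subequiv.of_finite fun C hC hCA => ?_
  -- Levels meeting `At j` go straight to the slots chosen by `ψ`. A remainder piece first enters an
  -- `S'` level by `σ`, and then goes to the slot reserved for that level and `j`. Several pieces
  -- may share a reserved slot; they stay apart because the sets `σ l • U l` are disjoint.
  let κ := (Σ i, {q // q ∈ a i}) ⊕ ((Σ i, {q // q ∈ S' i ×ˢ (Finset.univ : Finset J)}) × Fin p)
  let base : κ → Fin m := Sum.elim (fun k => k.1) (fun k => k.1.1)
  let tgt : κ → H × J := Sum.elim (fun k => (ψ k.1 (Sum.inl k.2)).1)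
    (fun k => (ψ k.1.1 (Sum.inr k.1.2)).1)
  let O : κ → Set X := Sum.elim (fun k => β k.2.1.2 • (k.2.1.1 • V k.1))
    (fun k => β k.1.2.1.2 • (U k.2 ∩ (σ k.2)⁻¹ • k.1.2.1.1 • V k.1.1))
  let e : κ → G := fun κ' => β (tgt κ').2 * ((tgt κ').1 : G) *
    Sum.elim (fun k : (Σ i, {q // q ∈ a i}) => (k.2.1.1 : G)⁻¹ * (β k.2.1.2)⁻¹)
    (fun k : ((Σ i, {q // q ∈ S' i ×ˢ (Finset.univ : Finset J)}) × Fin p) =>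
      (k.1.2.1.1 : G)⁻¹ * (σ k.2 : G) * (β k.1.2.1.2)⁻¹) κ'
  have htgt : ∀ k, (tgt k).1 ∈ S (base k) ∧ (tgt k).1 • V (base k) ⊆ Bt (tgt k).2 := by
    rintro (k | k)
    · exact hbmem _ _
    · exact hbmem _ _
  -- Each moved point is described by a base point and its target slot. For remainder pieces the
  -- base point also remembers the translate `σ l • U l`.
  have hloc : ∀ k, ∀ z ∈ e k • O k, ∃ v ∈ V (base k), z = β (tgt k).2 • (tgt k).1 • v ∧
      ∀ k', k = Sum.inr k' → k'.1.2.1.1 • v ∈ σ k'.2 • U k'.2 := by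
    rintro (k | k) z hz
    · obtain ⟨_, ⟨_, ⟨v, hv, rfl⟩, rfl⟩, rfl⟩ := hz
      refine ⟨v, hv, ?_, fun k' hk' => by cases hk'⟩
      simp only [e, Sum.elim_inl, Subgroup.smul_def, smul_smul]
      congr 1
      group
    · obtain ⟨_, ⟨u, ⟨huU, v', ⟨v, hv, rfl⟩, hv'⟩, rfl⟩, rfl⟩ := hz
      refine ⟨v, hv, ?_, fun k' hk' => ?_⟩
      · simp only at hv'
        subst hv'
        simp only [e, Sum.elim_inr, Subgroup.smul_def, smul_smul]
        congr 1
        push_cast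
        group
      · cases hk'
        simp only at hv'
        refine ⟨u, huU, ?_⟩
        simp only
        rw [← hv', smul_inv_smul]
  refine ⟨κ, inferInstance, O, e, ?_, ?_, ?_, ?_⟩
  · rintro (k | k)
    · exact ((hV _).smul _).smul _
    · exact ((hUo _).inter (((hV _).smul _).smul _)).smul _
  · intro x hx
    obtain ⟨j, hj⟩ := Set.mem_iUnion.1 (hCA hx)
    have hy : (β j)⁻¹ • x ∈ At j := Set.smul_mem_smul_set hj
    by_cases hR : (β j)⁻¹ • x ∈ (⋃ i, footprint (S i) (V i))ᶜ
    · obtain ⟨k, hk⟩ := Set.mem_iUnion.1 (hUcov hR)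
      obtain ⟨i, hi⟩ := Set.mem_iUnion.1 (hUsub k (Set.smul_mem_smul_set hk))
      obtain ⟨s, hs, hxs⟩ := mem_footprint.1 hi
      refine Set.mem_iUnion.2 ⟨Sum.inr (⟨i, ⟨(s, j), by simp [hs]⟩⟩, k), ?_⟩
      refine Set.mem_smul_set_iff_inv_smul_mem.2 ⟨hk, ?_⟩
      rw [Set.mem_smul_set_iff_inv_smul_mem, inv_inv]
      exact hxs
    · rw [Set.notMem_compl_iff] at hR
      obtain ⟨i, hi⟩ := Set.mem_iUnion.1 hR
      obtain ⟨s, hs, hxs⟩ := mem_footprint.1 hi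
      refine Set.mem_iUnion.2 ⟨Sum.inl ⟨i, ⟨(s, j), ?_⟩⟩, ?_⟩
      · exact Finset.mem_filter.2 ⟨by simp [hs], _, hxs, hy⟩
      · exact Set.mem_smul_set_iff_inv_smul_mem.2 hxs
  · intro k k' hkk
    rw [Set.disjoint_left]
    intro z hz hz'
    obtain ⟨v, hv, hzv, hk⟩ := hloc k z hz
    obtain ⟨v', hv', hzv', hk'⟩ := hloc k' z hz'
    have hzB := (hmBt _ _).1 ((htgt k).2 (Set.smul_mem_smul_set hv))
    have hzB' := (hmBt _ _).1 ((htgt k').2 (Set.smul_mem_smul_set hv'))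
    rw [← hzv] at hzB
    rw [← hzv'] at hzB'
    have hj : (tgt k).2 = (tgt k').2 := by
      by_contra hne
      exact Set.disjoint_left.1 (hdisj _ _ hne) hzB hzB'
    have hvv : (tgt k).1 • v = (tgt k').1 • v' := by
      rw [hzv, hj] at hzv'
      exact smul_left_cancel _ hzv'
    have hbs : (base k, (tgt k).1) = (base k', (tgt k').1) := by
      by_contra hne
      exact Set.disjoint_left.1 (hcas.disjoint_levels (htgt k).1 (htgt k').1 hne)
        (Set.smul_mem_smul_set hv) (hvv ▸ Set.smul_mem_smul_set hv')
    have hbase : base k = base k' := congrArg Prod.fst hbs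
    have htt : tgt k = tgt k' := Prod.ext (congrArg Prod.snd hbs) hj
    have hveq : v = v' := by
      rw [htt] at hvv
      exact smul_left_cancel _ hvv
    subst hveq
    rcases k with ⟨i, q⟩ | ⟨⟨i, q⟩, l⟩ <;> rcases k' with ⟨i', q'⟩ | ⟨⟨i', q'⟩, l'⟩ <;>
      (have hii : i = i' := hbase; subst hii; have hq := (ψ i).injective (Subtype.ext htt))
    · have hqq := Sum.inl.inj hq
      subst hqq
      exact hkk rfl
    · cases hq
    · cases hq
    · have hqq := Sum.inr.inj hq
      subst hqq
      have hl : l ≠ l' := by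
        rintro rfl
        exact hkk rfl
      exact Set.disjoint_left.1 (hUdisj l l' hl) (hk _ rfl) (hk' _ rfl)
  · intro k z hz
    obtain ⟨v, hv, hzv, -⟩ := hloc k z hz
    have hzB := (hmBt _ _).1 ((htgt k).2 (Set.smul_mem_smul_set hv))
    rw [← hzv] at hzB
    exact Set.mem_iUnion.2 ⟨_, hzB⟩

end Comparison

/-! ### Boxes as Følner sets of the extension -/

section Box

variable {G : Type*} [Group G] {H : Subgroup G}

/-- The set of all `g ^ j * h` with `j < N` and `h ∈ E`. -/
noncomputable def box (g : G) (N : ℕ) (E : Finset H) : Finset G :=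
  (Finset.range N ×ˢ E).image fun p => g ^ p.1 * p.2

theorem mem_box {g : G} {N : ℕ} {E : Finset H} {x : G} :
    x ∈ box g N E ↔ ∃ j < N, ∃ h ∈ E, g ^ j * (h : G) = x := by
  simp only [box, Finset.mem_image, Finset.mem_product, Finset.mem_range, Prod.exists]
  exact ⟨fun ⟨j, h, ⟨hj, hh⟩, e⟩ => ⟨j, hj, h, hh, e⟩, fun ⟨j, hj, h, hh, e⟩ => ⟨j, h, ⟨hj, hh⟩, e⟩⟩

theorem pow_mul_injective {g : G} (hg : ∀ k : ℤ, g ^ k ∈ H → k = 0) :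
    Function.Injective fun p : ℕ × H => g ^ p.1 * (p.2 : G) := by
  rintro ⟨j, h⟩ ⟨j', h'⟩ he
  simp only at he
  have h1 : g ^ ((j' : ℤ) - j) = h * (h' : G)⁻¹ := by
    rw [show (j' : ℤ) - j = -j + j' by ring, zpow_add, zpow_neg, zpow_natCast, zpow_natCast, inv_mul_eq_iff_eq_mul, ← mul_assoc, he]
    simp
  have h2 := hg _ (h1 ▸ H.mul_mem h.2 (H.inv_mem h'.2))
  obtain rfl : j = j' := by omega
  have h3 : (h : G) = h' := mul_left_cancel he
  rw [Subtype.ext h3]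

theorem card_box {g : G} (hg : ∀ k : ℤ, g ^ k ∈ H → k = 0) (N : ℕ) (E : Finset H) :
    (box g N E).card = N * E.card := by
  rw [box, Finset.card_image_of_injective _ (pow_mul_injective hg), Finset.card_product,
    Finset.card_range]

theorem sum_box {g : G} (hg : ∀ k : ℤ, g ^ k ∈ H → k = 0) (N : ℕ) (E : Finset H) (f : G → ℝ) :
    ∑ t ∈ box g N E, f t = ∑ h ∈ E, ∑ j ∈ Finset.range N, f (g ^ j * h) := by
  rw [box, Finset.sum_image fun x _ y _ h => pow_mul_injective hg h, Finset.sum_product,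
    Finset.sum_comm]

/-- With `γ = g ^ e * k₀` one has `γ * g ^ j * h = g ^ (e + j) * c j * h`, where `c j` is a
conjugate of `k₀`. The product leaves the box only if `j` is among `|e|` extreme exponents or `c j`
pushes `h` out of `E`. The conjugates depend on `j < N`, so `N` is fixed before `E`. -/
theorem eventually_card_translate_box_le [H.Normal] {g : G}
    (hg : ∀ k : ℤ, g ^ k ∈ H → k = 0) (hgen : ∀ x : G, ∃ k : ℤ, ∃ h : H, x = g ^ k * h) (γ : G)
    {η : ℝ} (hη : 0 < η) :
    ∃ N₀ : ℕ, ∀ N ≥ N₀, ∀ᶠ E in folner H,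
      (((box g N E).filter fun u => γ * u ∉ box g N E).card : ℝ) ≤ η * (box g N E).card := by
  obtain ⟨e, k₀, rfl⟩ := hgen γ
  obtain ⟨N₀, hN₀⟩ := exists_nat_ge (e.natAbs / (η / 2))
  refine ⟨N₀, fun N hN => ?_⟩
  have hN' : (e.natAbs : ℝ) ≤ η / 2 * N := by
    rw [div_le_iff₀' (by positivity)] at hN₀
    refine hN₀.trans ?_
    gcongr
  set c : ℕ → H := fun j => MulAut.conjNormal (g ^ j)⁻¹ k₀ with hc
  have hcj : ∀ j, (k₀ : G) * g ^ j = g ^ j * c j := fun j => by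
    rw [hc, MulAut.conjNormal_apply]
    group
  filter_upwards [(Finset.eventually_all (Finset.range N)).2 fun j _ =>
    eventually_card_translate_le (c j) (half_pos hη)] with E hE
  set T : Finset ℕ := if e < 0 then Finset.range e.natAbs else Finset.Ico (N - e.natAbs) N with hT
  have hTcard : T.card ≤ e.natAbs := by
    rw [hT]
    split_ifs
    · simp
    · rw [Nat.card_Ico]; omega
  have hsub : (box g N E).filter (fun u => g ^ e * k₀ * u ∉ box g N E) ⊆
      (T ×ˢ E ∪ (Finset.range N).biUnion fun j =>
        (E.filter fun h => c j * h ∉ E).image fun h => (j, h)).image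
        fun p => g ^ p.1 * (p.2 : G) := by
    intro u hu
    obtain ⟨hu, hu'⟩ := Finset.mem_filter.1 hu
    obtain ⟨j, hj, h, hh, rfl⟩ := mem_box.1 hu
    refine Finset.mem_image.2 ⟨(j, h), ?_, rfl⟩
    rw [Finset.mem_union]
    by_cases hjT : j ∈ T
    · exact Or.inl (Finset.mem_product.2 ⟨hjT, hh⟩)
    · right
      refine Finset.mem_biUnion.2 ⟨j, Finset.mem_range.2 hj, Finset.mem_image.2 ⟨h, ?_, rfl⟩⟩
      refine Finset.mem_filter.2 ⟨hh, fun hch => hu' ?_⟩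
      have hr : 0 ≤ e + j ∧ e + j < N := by
        rw [hT] at hjT
        split_ifs at hjT with he
        · rw [Finset.mem_range] at hjT; omega
        · rw [Finset.mem_Ico] at hjT; omega
      refine mem_box.2 ⟨(e + j).toNat, by omega, _, hch, ?_⟩
      rw [← zpow_natCast g (e + j).toNat, Int.toNat_of_nonneg hr.1, zpow_add, zpow_natCast]
      push_cast
      rw [mul_assoc, ← mul_assoc (g ^ j), ← hcj, mul_assoc, mul_assoc]
  have h1 : ((box g N E).filter (fun u => g ^ e * k₀ * u ∉ box g N E)).card ≤
      e.natAbs * E.card + ∑ j ∈ Finset.range N, (E.filter fun h => c j * h ∉ E).card := by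
    refine (Finset.card_le_card hsub).trans (Finset.card_image_le.trans
      ((Finset.card_union_le _ _).trans (add_le_add ?_ (Finset.card_biUnion_le.trans
        (Finset.sum_le_sum fun j _ => Finset.card_image_le)))))
    rw [Finset.card_product]
    exact Nat.mul_le_mul_right _ hTcard
  have h2 : (∑ j ∈ Finset.range N, (E.filter fun h => c j * h ∉ E).card : ℝ) ≤
      N * (η / 2 * E.card) := by
    refine (Finset.sum_le_card_nsmul _ _ (η / 2 * E.card) fun j hj => ?_).trans ?_
    · refine le_trans (le_of_eq ?_) (hE j hj)
      congr!
    rw [Finset.card_range, nsmul_eq_mul]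
  have h3 : (((box g N E).filter (fun u => g ^ e * k₀ * u ∉ box g N E)).card : ℝ) ≤
      e.natAbs * E.card + ∑ j ∈ Finset.range N, ((E.filter fun h => c j * h ∉ E).card : ℝ) := by
    exact_mod_cast h1
  have h4 : (e.natAbs : ℝ) * E.card ≤ η / 2 * N * E.card := by gcongr
  rw [card_box hg]
  push_cast
  linarith

/-- Boxes are as invariant as one wishes. -/
theorem exists_box_isInvariant [H.Normal] {g : G} (hg : ∀ k : ℤ, g ^ k ∈ H → k = 0)
    (hgen : ∀ x : G, ∃ k : ℤ, ∃ h : H, x = g ^ k * h) (K : Finset G) {δ : ℝ} (hδ : 0 < δ) :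
    ∃ N₀ : ℕ, ∀ N ≥ N₀, ∀ᶠ E in folner H, IsInvariant K δ (box g N E) := by
  have hη : 0 < δ / ((K.card : ℝ) * K.card + 1) := by positivity
  choose N₀ hN₀ using fun γ => eventually_card_translate_box_le hg hgen γ hη
  refine ⟨(K ×ˢ K).sup fun p => N₀ (p.2 * p.1⁻¹), fun N hN => ?_⟩
  filter_upwards [(Finset.eventually_all (K ×ˢ K)).2 fun p hp =>
    hN₀ (p.2 * p.1⁻¹) N ((Finset.le_sup (f := fun p => N₀ (p.2 * p.1⁻¹)) hp).trans hN)] with E hE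
  refine isInvariant_of_card_translate_le
    (fun k hk k' hk' => hE (k, k') (Finset.mem_product.2 ⟨hk, hk'⟩)) ?_
  rw [mul_div_assoc', div_le_iff₀ (by positivity)]
  nlinarith

theorem exists_box_of_eventually [H.Normal] [(folner H).NeBot] {g : G}
    (hg : ∀ k : ℤ, g ^ k ∈ H → k = 0) (hgen : ∀ x : G, ∃ k : ℤ, ∃ h : H, x = g ^ k * h)
    {p : Finset G → Prop} (hp : ∀ᶠ F in folner G, p F) :
    ∃ N : ℕ, 0 < N ∧ ∃ E : Finset H, E.Nonempty ∧ p (box g N E) := by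
  obtain ⟨K, δ, hδ, hK⟩ := eventually_folner.1 hp
  obtain ⟨N₀, hN₀⟩ := exists_box_isInvariant hg hgen K hδ
  obtain ⟨E, hE, hE'⟩ := ((hN₀ (N₀ + 1) (by omega)).and eventually_nonempty).exists
  refine ⟨N₀ + 1, by omega, E, hE', hK _ ?_ hE⟩
  rw [← Finset.card_pos, card_box hg]
  exact Nat.mul_pos (by omega) hE'.card_pos

end Box

/-! ### Comparison for the extension by the integers -/

section Comparison

open Filter Topology Metric

variable {G : Type*} [Group G] {X : Type*} [MetricSpace X] [CompactSpace X] [MulAction G X]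
  [ContinuousConstSMul G X] {H : Subgroup G}

/-- Comparison for the action of an extension by the integers. -/
theorem AlmostFinite.subequiv_extension [H.Normal] [Infinite H] (hH : AlmostFinite H X) [Nonempty X]
    {g : G} (hg : ∀ k : ℤ, g ^ k ∈ H → k = 0) (hgen : ∀ x : G, ∃ k : ℤ, ∃ h : H, x = g ^ k * h)
    {A B : Set X} (hA : IsClosed A) (hB : IsOpen B) {c : ℝ} (hc : c < 0)
    (h : UpperDensityLE G (fun x => ind A x - ind B x) c) : Subequiv G A B := by
  have := hH.neBot_folner
  obtain ⟨N, hN, E, hE, hbox⟩ := exists_box_of_eventually hg hgen (h (-c / 2) (by linarith))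
  have hN' : (0 : ℝ) < N := Nat.cast_pos.2 hN
  have hE' : (0 : ℝ) < E.card := Nat.cast_pos.2 hE.card_pos
  let D : ℕ × Bool → Set X := fun k => if k.2 then A else Bᶜ
  -- An average over a box is an average over `E` of a sum along powers of `g`. The box inequality
  -- is therefore a density bound for `H`; the summand `N` again comes from passing to complements.
  have h1 : UpperDensityLE H (fun x => ∑ k ∈ Finset.range N ×ˢ (Finset.univ : Finset Bool),
      ind (D k) (g ^ k.1 • x)) (c / 2 * N + N) := by
    refine UpperDensityLE.of_sum_le
      (M := (Finset.range N ×ˢ (Finset.univ : Finset Bool)).card) (fun x => ?_) hE fun x => ?_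
    · refine (Finset.abs_sum_le_sum_abs _ _).trans ?_
      refine (Finset.sum_le_card_nsmul _ _ 1 fun k _ => abs_ind_le_one _ _).trans ?_
      simp
    · have h2 := hbox x
      rw [sum_box hg, card_box hg] at h2
      have h3 : ∀ t : H, ∑ k ∈ Finset.range N ×ˢ (Finset.univ : Finset Bool),
          ind (D k) (g ^ k.1 • t • x) = ∑ j ∈ Finset.range N,
            (ind A ((g ^ j * (t : G)) • x) - ind B ((g ^ j * (t : G)) • x)) + N := by
        intro t
        have h4 : (N : ℝ) = ∑ j ∈ Finset.range N, 1 := by simp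
        rw [Finset.sum_product, h4, ← Finset.sum_add_distrib]
        refine Finset.sum_congr rfl fun j _ => ?_
        simp only [D, Fintype.sum_bool, if_true, Bool.false_eq_true, if_false, ind_compl, mul_smul,
          Subgroup.smul_def]
        ring
      rw [Finset.sum_congr rfl fun t _ => h3 t, Finset.sum_add_distrib, Finset.sum_const,
        nsmul_eq_mul]
      push_cast at h2
      linarith
  obtain ⟨δ, hδ, h2⟩ := eventually_nhdsGT_of_nhds (h1.eventually_cthickening _ D
    (fun k => by
      simp only [D]
      split_ifs
      exacts [hA, hB.isClosed_compl])
    (fun k x => g ^ k.1 • x) (fun k => continuous_const_smul _)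
    (show c / 2 * N + N < c / 4 * N + N by nlinarith))
  have hη : 0 < -c / (8 * N) := div_pos (by linarith) (by positivity)
  obtain ⟨A', B', hA', hAA', hB', hdisj, hBB', hdens⟩ := hH.exists_split (B := B) hA hN hη hδ
  -- Each piece carries a share `1 / N`, so shifting the `j`-th one by `g ^ j` gives the average of
  -- the thickened functions along `g`. That average contributes `c / 4`, and the `N` splitting
  -- errors add at most `-c / 8`.
  have h3 : UpperDensityLE H (fun x => ∑ j : Fin N,
      (ind (A' j) (g ^ (j : ℕ) • x) - ind (B' j) (g ^ (j : ℕ) • x))) (c / 8) := by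
    have h4 := (UpperDensityLE.sum Finset.univ
      fun j _ => (hdens j).comp_smul_normal (g ^ (j : ℕ))).add
      ((h2.add (UpperDensityLE.of_le H (f := fun _ => -(N : ℝ)) fun _ => le_rfl)).const_mul
        (show (0 : ℝ) ≤ 1 / N by positivity))
    refine h4.mono (fun x => le_of_eq ?_) (le_of_eq ?_)
    · have h5 : ∑ k ∈ Finset.range N ×ˢ (Finset.univ : Finset Bool),
          ind (cthickening δ (D k)) (g ^ k.1 • x) + -(N : ℝ) = ∑ j : Fin N,
            (ind (cthickening δ A) (g ^ (j : ℕ) • x) +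
              ind (cthickening δ Bᶜ) (g ^ (j : ℕ) • x) - 1) := by
        rw [Finset.sum_sub_distrib, Finset.sum_product, Finset.sum_range]
        simp only [D, Fintype.sum_bool, if_true, Bool.false_eq_true, if_false, Finset.sum_const,
          Finset.card_univ, Fintype.card_fin, nsmul_eq_mul, mul_one]
        ring
      rw [h5, Finset.mul_sum, ← Finset.sum_add_distrib]
      refine Finset.sum_congr rfl fun j _ => ?_
      ring
    · rw [Finset.sum_const, Finset.card_univ, Fintype.card_fin, nsmul_eq_mul]
      field_simp
      ring
  have h4 := hH.subequiv_of_upperDensityLE hA' hB' hdisj (fun j : Fin N => g ^ (j : ℕ))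
    (by linarith) h3
  intro C hC hCA
  obtain ⟨m, U, s, e1, e2, e3, e4⟩ := h4 C hC (hCA.trans hAA')
  exact ⟨m, U, s, e1, e2, e3, fun i => (e4 i).trans (Set.iUnion_subset hBB')⟩

end Comparison

/-! ### Ornstein–Weiss quasi-tilings for free actions -/

section QuasiTiling

open Filter Topology Metric

universe u

variable {G : Type u} [Group G] {X : Type*} [MetricSpace X] [MulAction G X]

/-- Sets of small diameter are bases of towers with small levels. -/
theorem IsFreeAction.exists_isTower [CompactSpace X] [ContinuousConstSMul G X]
    (hfree : IsFreeAction G X) (T : Finset G) {δ : ℝ} (hδ : 0 < δ) :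
    ∃ r : ℝ, 0 < r ∧ ∀ V : Set X, (∀ x ∈ V, ∀ y ∈ V, dist x y < r) →
      IsTower T V ∧ ∀ t ∈ T, diam (t • V) < δ := by
  -- Freeness and compactness bound the displacement of a nontrivial element away from zero.
  have h1 : ∀ γ : G, γ ≠ 1 → ∀ᶠ r in 𝓝[>] (0 : ℝ), ∀ x : X, r ≤ dist (γ • x) x := by
    intro γ hγ
    obtain ⟨a, ha, ha'⟩ := isCompact_univ.exists_forall_le' (f := fun x : X => dist (γ • x) x)
      (a := 0) ((continuous_const_smul γ).dist continuous_id).continuousOn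
      (fun x _ => dist_pos.2 fun h => hγ (hfree γ x h))
    filter_upwards [nhdsWithin_le_nhds (Iio_mem_nhds ha)] with r hr x
    exact (le_of_lt hr).trans (ha' x trivial)
  have h2 : ∀ t : G, ∀ᶠ r in 𝓝[>] (0 : ℝ), ∀ x y : X, dist x y < r →
      dist (t • x) (t • y) < δ / 2 := by
    intro t
    obtain ⟨a, ha, ha'⟩ := Metric.uniformContinuous_iff.1
      (CompactSpace.uniformContinuous_of_continuous (continuous_const_smul t : Continuous
        fun x : X => t • x)) (δ / 2) (half_pos hδ)
    filter_upwards [nhdsWithin_le_nhds (Iio_mem_nhds ha)] with r hr x y hxy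
    exact ha' (hxy.trans hr)
  have h3 : ∀ᶠ r in 𝓝[>] (0 : ℝ), ∀ p ∈ T ×ˢ T, p.1 ≠ p.2 →
      ∀ x : X, r ≤ dist ((p.2⁻¹ * p.1) • x) x :=
    (Finset.eventually_all _).2 fun p _ => by
      by_cases hp : p.1 = p.2
      · exact Eventually.of_forall fun r h => (h hp).elim
      · filter_upwards [h1 (p.2⁻¹ * p.1) (fun h => hp (inv_mul_eq_one.1 h).symm)] with r hr _
        exact hr
  obtain ⟨r, ⟨hr1, hr2⟩, hr⟩ := ((h3.and ((Finset.eventually_all T).2 fun t _ => h2 t)).and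
    self_mem_nhdsWithin).exists
  refine ⟨r, hr, fun V hV => ⟨fun s hs t ht hst => Set.disjoint_left.2 ?_, fun t ht => ?_⟩⟩
  · rintro _ ⟨v, hv, rfl⟩ ⟨w, hw, hvw⟩
    simp only at hvw
    have := hr1 (s, t) (Finset.mem_product.2 ⟨hs, ht⟩) hst v
    rw [mul_smul, ← hvw, inv_smul_smul] at this
    exact absurd (hV w hw v hv) (not_lt.2 this)
  · refine (diam_le_of_forall_dist_le (half_pos hδ).le ?_).trans_lt (half_lt_self hδ)
    rintro _ ⟨v, hv, rfl⟩ _ ⟨w, hw, rfl⟩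
    exact (hr2 t ht v w (hV v hv w hw)).le

/-- The set `D` is tiled by almost disjoint tiles with shapes satisfying `p`: each shape `T i` has a
subset `E i` of proportion at least `1 - ε`, such that the `E i` are the shapes of a castle which
still covers all tiles of the original shapes. -/
def IsQuasiTiled (p : Finset G → Prop) (ε δ : ℝ) (D : Set X) : Prop :=
  ∃ (ι : Type u) (_ : Finite ι) (T E : ι → Finset G) (V : ι → Set X), (∀ i, p (T i)) ∧
    (∀ i, E i ⊆ T i) ∧ (∀ i, (1 - ε) * (T i).card ≤ (E i).card) ∧ (∀ i, NullFrontier G (V i)) ∧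
    IsCastle E V ∧ (∀ i, ∀ s ∈ E i, diam (s • V i) < δ) ∧ D = ⋃ i, footprint (E i) (V i) ∧
    ∀ i, footprint (T i) (V i) ⊆ D

theorem IsQuasiTiled.mono {p q : Finset G → Prop} {ε δ : ℝ} {D : Set X}
    (h : IsQuasiTiled p ε δ D) (hpq : ∀ F, p F → q F) : IsQuasiTiled q ε δ D := by
  obtain ⟨ι, hι, T, E, V, h1, h2⟩ := h
  exact ⟨ι, hι, T, E, V, fun i => hpq _ (h1 i), h2⟩

theorem isQuasiTiled_empty (p : Finset G → Prop) (ε δ : ℝ) : IsQuasiTiled p ε δ (∅ : Set X) :=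
  ⟨PEmpty, inferInstance, PEmpty.elim, PEmpty.elim, PEmpty.elim, by simp, by simp, by simp,
    by simp, ⟨by simp, by simp⟩, by simp, by simp, by simp⟩

/-- The set of points at which a quasi-tiled set is not invariant has small density. -/
theorem IsQuasiTiled.upperDensityLE_boundary {T : Finset G} {ε δ η : ℝ} (hη : 0 ≤ η)
    {D : Set X} (h : IsQuasiTiled (IsInvariant T (η * (1 - ε))) ε δ D) :
    UpperDensityLE G (ind {x | (∃ t ∈ T, t • x ∈ D) ∧ ∃ t ∈ T, t • x ∉ D}) η := by
  obtain ⟨ι, hι, T₀, E, V, h1, h2, h3, -, h5, -, h7, h8⟩ := h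
  have := Fintype.ofFinite ι
  have h9 := UpperDensityLE.of_card_le (fun i => (boundary_finite T (T₀ i)).toFinset) E η V
    (fun i => by
      rw [← Set.ncard_eq_toFinset_card _ (boundary_finite T (T₀ i))]
      refine (h1 i).trans ?_
      rw [mul_assoc]
      exact mul_le_mul_of_nonneg_left (h3 i) hη)
  refine (h9.add (UpperDensityLE.of_le G (f := fun x => η * ∑ i, ∑ s ∈ E i, ind (s • V i) x)
    (c := η) fun x => ?_)).mono (fun x => ?_) (by simp)
  · rw [h5.sum_ind]
    exact mul_le_of_le_one_right hη (ind_le_one _ _)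
  · rw [sub_add_cancel, Finset.sum_sigma']
    refine ind_iUnion_le _ (fun q : (_ : ι) × G => q.2 • V q.1) _ ?_ x
    rintro y ⟨⟨t, ht, hty⟩, t', ht', hty'⟩
    have hty2 := hty
    rw [h7] at hty
    obtain ⟨i, hi⟩ := Set.mem_iUnion.1 hty
    obtain ⟨s, hs, v, hv, hsv⟩ := mem_footprint.1 hi
    simp only at hsv
    -- If `t • y` is the point `s • v` of a tile, then `y` has coordinate `t⁻¹ * s` over `v`. It
    -- lies in the `T`-boundary of the full shape, because all tiles with full shapes lie in `D`.
    refine Set.mem_iUnion₂.2 ⟨⟨i, t⁻¹ * s⟩, ?_, v, hv, ?_⟩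
    · simp only [Finset.mem_sigma, Finset.mem_univ, true_and, Set.Finite.mem_toFinset]
      refine ⟨⟨t, ht, by simpa using h2 i hs⟩, t', ht', fun hT => hty' ?_⟩
      refine h8 i (mem_footprint.2 ⟨_, hT, v, hv, ?_⟩)
      simp only
      rw [mul_smul, mul_smul, hsv, inv_smul_smul]
    · simp only
      rw [mul_smul, hsv, inv_smul_smul]

variable [ContinuousConstSMul G X]

theorem NullFrontier.footprint {V : Set X} (hV : NullFrontier G V) (S : Finset G) :
    NullFrontier G (footprint S V) :=
  NullFrontier.biUnion S fun s _ => hV.smul s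

theorem IsQuasiTiled.nullFrontier {p : Finset G → Prop} {ε δ : ℝ} {D : Set X}
    (h : IsQuasiTiled p ε δ D) : NullFrontier G D := by
  obtain ⟨ι, hι, T, E, V, -, -, -, h4, -, -, h7, -⟩ := h
  have := Fintype.ofFinite ι
  rw [h7]
  simpa using NullFrontier.biUnion Finset.univ fun i _ => (h4 i).footprint (E i)

/-- Adding tiles with base points in a given set. -/
theorem IsQuasiTiled.exists_add {p : Finset G → Prop} {ε δ : ℝ} (hε : ε ≤ 1) {D : Set X}
    (h : IsQuasiTiled p ε δ D) {T : Finset G} (hT : p T) {O : Set X} (hO : NullFrontier G O)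
    (hTO : IsTower T O) (hdiam : ∀ t ∈ T, diam (t • O) < δ) [CompactSpace X] :
    ∃ D' : Set X, D ⊆ D' ∧ IsQuasiTiled p ε δ D' ∧
      ∀ x ∈ O, ε * T.card ≤ ∑ t ∈ T, ind D' (t • x) := by
  have hD := h.nullFrontier
  obtain ⟨ι, hι, T₀, E₀, V₀, h1, h2, h3, h4, h5, h6, h7, h8⟩ := h
  let κ := {E : Finset G // E ∈ T.powerset.filter fun E : Finset G => (1 - ε) * T.card ≤ E.card}
  have hκfin : Finite κ := Finite.of_fintype
    {E : Finset G // E ∈ T.powerset.filter fun E : Finset G => (1 - ε) * T.card ≤ E.card}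
  have hκ : ∀ E : κ, E.1 ⊆ T ∧ (1 - ε) * T.card ≤ E.1.card := fun E => by
    have := Finset.mem_filter.1 E.2
    exact ⟨Finset.mem_powerset.1 this.1, this.2⟩
  let W : κ → Set X := fun E => O ∩ ⋂ t ∈ T, if t ∈ E.1 then t⁻¹ • Dᶜ else t⁻¹ • D
  have hW : ∀ E x, x ∈ W E ↔ x ∈ O ∧ ∀ t ∈ T, (t • x ∉ D ↔ t ∈ E.1) := by
    intro E x
    refine and_congr_right fun _ => ?_
    rw [Set.mem_iInter₂]
    refine forall₂_congr fun t _ => ?_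
    split_ifs with ht <;> simp [Set.mem_smul_set_iff_inv_smul_mem, ht]
  have hWn : ∀ E, NullFrontier G (W E) := by
    intro E
    refine hO.inter (NullFrontier.biInter T fun t _ => ?_)
    split_ifs
    · exact hD.compl.smul _
    · exact hD.smul _
  have hWO : ∀ E, W E ⊆ O := fun E => Set.inter_subset_left
  have hdisj : ∀ i (E : κ), Disjoint (footprint (E₀ i) (V₀ i)) (footprint E.1 (W E)) := by
    intro i E
    refine Set.disjoint_left.2 fun x hx hx' => ?_
    obtain ⟨t, ht, v, hv, rfl⟩ := mem_footprint.1 hx'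
    refine (((hW E v).1 hv).2 t ((hκ E).1 ht)).2 ht ?_
    rw [h7]
    exact Set.mem_iUnion.2 ⟨i, hx⟩
  set D' := ⋃ i, footprint (Sum.elim E₀ (fun E : κ => E.1) i) (Sum.elim V₀ W i) with hD'
  have hDD' : D ⊆ D' := by
    rw [h7]
    exact Set.iUnion_subset fun i => Set.subset_iUnion
      (fun i => footprint (Sum.elim E₀ (fun E : κ => E.1) i) (Sum.elim V₀ W i)) (Sum.inl i)
  have hWD' : ∀ E, footprint T (W E) ⊆ D' := by
    intro E x hx
    obtain ⟨t, ht, v, hv, rfl⟩ := mem_footprint.1 hx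
    by_cases htD : t • v ∈ D
    · exact hDD' htD
    · refine Set.mem_iUnion.2 ⟨Sum.inr E, mem_footprint.2 ⟨t, ?_, v, hv, rfl⟩⟩
      exact (((hW E v).1 hv).2 t ht).1 htD
  refine ⟨D', hDD', ⟨ι ⊕ κ, inferInstance, Sum.elim T₀ (fun _ => T),
    Sum.elim E₀ (fun E => E.1), Sum.elim V₀ W, ?_, ?_, ?_, ?_, ⟨?_, ?_⟩, ?_, hD', ?_⟩, ?_⟩
  · rintro (i | E)
    exacts [h1 i, hT]
  · rintro (i | E)
    exacts [h2 i, (hκ E).1]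
  · rintro (i | E)
    exacts [h3 i, (hκ E).2]
  · rintro (i | E)
    exacts [h4 i, hWn E]
  · rintro (i | E)
    exacts [h5.1 i, hTO.mono (hκ E).1 (hWO E)]
  · rintro (i | E) (j | E') hne
    · exact h5.2 i j fun he => hne (by rw [he])
    · exact hdisj i E'
    · exact (hdisj j E).symm
    · refine Set.disjoint_left.2 fun x hx hx' => hne ?_
      obtain ⟨t, ht, v, hv, rfl⟩ := mem_footprint.1 hx
      obtain ⟨t', ht', v', hv', he⟩ := mem_footprint.1 hx'
      obtain ⟨rfl, rfl⟩ := hTO.unique ((hκ E').1 ht') ((hκ E).1 ht) (hWO _ hv') (hWO _ hv) he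
      congr 1
      refine Subtype.ext (Finset.ext fun s => ⟨fun hs => ?_, fun hs => ?_⟩)
      · have hsT := (hκ E).1 hs
        exact (((hW E' _).1 hv').2 s hsT).1 ((((hW E _).1 hv).2 s hsT).2 hs)
      · have hsT := (hκ E').1 hs
        exact (((hW E _).1 hv).2 s hsT).1 ((((hW E' _).1 hv').2 s hsT).2 hs)
  · rintro (i | E) s hs
    · exact h6 i s hs
    · exact (diam_mono (Set.smul_set_mono (hWO E)) isBounded_of_compactSpace).trans_lt
        (hdiam s ((hκ E).1 hs))
  · rintro (i | E)
    exacts [(h8 i).trans hDD', hWD' E]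
  · intro x hx
    rw [sum_ind_eq_card]
    set E := T.filter fun t => t • x ∉ D with hE
    -- If too little of the tile is new for it to be added, then `D` already covers a proportion `ε`
    -- of it.
    by_cases hc : (1 - ε) * T.card ≤ E.card
    · have hEκ : E ∈ T.powerset.filter fun E => (1 - ε) * T.card ≤ E.card :=
        Finset.mem_filter.2 ⟨Finset.mem_powerset.2 (Finset.filter_subset _ _), hc⟩
      have hxW : x ∈ W ⟨E, hEκ⟩ := (hW _ _).2 ⟨hx, fun t ht => by simp [hE, ht]⟩
      rw [Finset.filter_true_of_mem fun t ht =>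
        hWD' _ (mem_footprint.2 ⟨t, ht, Set.smul_mem_smul_set hxW⟩)]
      exact mul_le_of_le_one_left (Nat.cast_nonneg _) hε
    · have hle : (T.filter fun t => t • x ∈ D).card ≤ (T.filter fun t => t • x ∈ D').card :=
        Finset.card_le_card (Finset.monotone_filter_right _ fun t _ ht => hDD' ht)
      have hsum := Finset.card_filter_add_card_filter_not (s := T) (fun t => t • x ∈ D)
      have h9 : ((T.filter fun t => t • x ∈ D).card : ℝ) + E.card = T.card := by
        exact_mod_cast hsum
      have h10 : ((T.filter fun t => t • x ∈ D).card : ℝ) ≤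
        (T.filter fun t => t • x ∈ D').card := by exact_mod_cast hle
      linarith

theorem IsQuasiTiled.exists_add_finset {p : Finset G → Prop} {ε δ : ℝ} (hε : ε ≤ 1) {D : Set X}
    (h : IsQuasiTiled p ε δ D) {T : Finset G} (hT : p T) {κ : Type*} (I : Finset κ) {O : κ → Set X}
    (hO : ∀ k ∈ I, NullFrontier G (O k)) (hTO : ∀ k ∈ I, IsTower T (O k))
    (hdiam : ∀ k ∈ I, ∀ t ∈ T, diam (t • O k) < δ) [CompactSpace X] :
    ∃ D' : Set X, D ⊆ D' ∧ IsQuasiTiled p ε δ D' ∧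
      ∀ k ∈ I, ∀ x ∈ O k, ε * T.card ≤ ∑ t ∈ T, ind D' (t • x) := by
  induction I using Finset.induction_on with
  | empty => exact ⟨D, le_rfl, h, by simp⟩
  | insert a I ha ih =>
    obtain ⟨D₁, hD₁, hq₁, hc₁⟩ := ih (fun k hk => hO k (by simp [hk]))
      (fun k hk => hTO k (by simp [hk])) (fun k hk => hdiam k (by simp [hk]))
    obtain ⟨D₂, hD₂, hq₂, hc₂⟩ := hq₁.exists_add hε hT (hO a (by simp)) (hTO a (by simp))
      (hdiam a (by simp))
    refine ⟨D₂, hD₁.trans hD₂, hq₂, fun k hk x hx => ?_⟩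
    rcases Finset.mem_insert.1 hk with rfl | hk
    · exact hc₂ x hx
    · exact (hc₁ k hk x hx).trans (Finset.sum_le_sum fun t _ => ind_mono hD₂ _)

variable [CompactSpace X] [(folner G).NeBot]

/-- One step of the Ornstein-Weiss procedure. -/
theorem exists_isQuasiTiled_step (hfree : IsFreeAction G X)
    (hsbp : ∀ A U : Set X, IsClosed A → IsOpen U → A ⊆ U →
      ∃ O : Set X, IsOpen O ∧ A ⊆ O ∧ O ⊆ U ∧ NullFrontier G O)
    {ε δ u u' : ℝ} (hε1 : ε < 1) (hδ : 0 < δ) (hu : (1 - ε) * u < u')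
    (h : ∀ p : Finset G → Prop, (∀ᶠ F in folner G, p F) →
      ∃ D : Set X, IsQuasiTiled p ε δ D ∧ UpperDensityLE G (ind Dᶜ) u)
    {p : Finset G → Prop} (hp : ∀ᶠ F in folner G, p F) :
    ∃ D : Set X, IsQuasiTiled p ε δ D ∧ UpperDensityLE G (ind Dᶜ) u' := by
  obtain ⟨T, hpT, hT⟩ := (hp.and eventually_nonempty).exists
  have hTc : (0 : ℝ) < T.card := Nat.cast_pos.2 hT.card_pos
  set η := u' - (1 - ε) * u with hη
  have hη0 : 0 < η := by linarith
  -- The new tile `T` is fixed first, and the earlier tiles are then required to be invariant under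
  -- it. The factor `1 - ε` accounts for passing from `T i` to the smaller `E i`.
  obtain ⟨D, hD, hDu⟩ := h (fun F => p F ∧ IsInvariant T (η * (1 - ε)) F)
    (hp.and (eventually_isInvariant T (mul_pos hη0 (by linarith))))
  obtain ⟨r, hr, hrV⟩ := hfree.exists_isTower T hδ
  have hO : ∀ x : X, ∃ O : Set X, IsOpen O ∧ x ∈ O ∧ O ⊆ ball x (r / 2) ∧ NullFrontier G O := by
    intro x
    obtain ⟨O, h1, h2, h3, h4⟩ := hsbp {x} (ball x (r / 2)) isClosed_singleton isOpen_ball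
      (by simpa using half_pos hr)
    exact ⟨O, h1, h2 rfl, h3, h4⟩
  choose O hOo hxO hOb hOn using hO
  obtain ⟨I, hI⟩ := isCompact_univ.elim_finite_subcover O hOo
    (fun x _ => Set.mem_iUnion.2 ⟨x, hxO x⟩)
  have hsmall : ∀ x, ∀ y ∈ O x, ∀ z ∈ O x, dist y z < r := fun x y hy z hz => by
    have := dist_triangle_right y z x
    have h1 := mem_ball.1 (hOb x hy)
    have h2 := mem_ball.1 (hOb x hz)
    linarith
  obtain ⟨D', hDD', hq, hcov⟩ := (hD.mono fun F hF => hF.1).exists_add_finset hε1.le hpT I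
    (fun k _ => hOn k) (fun k _ => (hrV _ (hsmall k)).1) (fun k _ => (hrV _ (hsmall k)).2)
  refine ⟨D', hq, ?_⟩
  have hcov' : ∀ x, ε * T.card ≤ ∑ t ∈ T, ind D' (t • x) := fun x => by
    obtain ⟨k, hk, hx⟩ := Set.mem_iUnion₂.1 (hI (Set.mem_univ x))
    exact hcov k hk x hx
  set b := {x | (∃ t ∈ T, t • x ∈ D) ∧ ∃ t ∈ T, t • x ∉ D} with hb
  have hbd : UpperDensityLE G (ind b) η :=
    (hD.mono fun F hF => hF.2).upperDensityLE_boundary hη0.le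
  -- If the translate of `T` at `x` lies in `D`, nothing is uncovered. If it misses `D`, the new set
  -- covers at least a proportion `ε`. The mixed case occurs only on `b`, of density at most `η`.
  have key : ∀ x, ∑ t ∈ T, ind D'ᶜ (t • x) ≤
      (1 - ε) * ∑ t ∈ T, ind Dᶜ (t • x) + T.card * ind b x := by
    intro x
    have hnn : 0 ≤ ∑ t ∈ T, ind Dᶜ (t • x) := Finset.sum_nonneg fun t _ => ind_nonneg _ _
    have hle : ∑ t ∈ T, ind D'ᶜ (t • x) ≤ T.card := by
      simpa using Finset.sum_le_card_nsmul T (fun t => ind D'ᶜ (t • x)) 1 fun t _ => ind_le_one _ _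
    by_cases h1 : ∃ t ∈ T, t • x ∈ D
    · by_cases h2 : ∃ t ∈ T, t • x ∉ D
      · rw [ind_of_mem (show x ∈ b from ⟨h1, h2⟩), mul_one]
        nlinarith
      · push Not at h2
        rw [Finset.sum_eq_zero fun t ht => ind_of_notMem (by simpa using hDD' (h2 t ht))]
        have := ind_nonneg b x
        have h3 : 0 ≤ (1 - ε) := by linarith
        positivity
    · push Not at h1
      have e1 : ∑ t ∈ T, ind Dᶜ (t • x) = T.card := by
        rw [Finset.sum_congr rfl fun t ht => ind_of_mem (show t • x ∈ Dᶜ from h1 t ht)]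
        simp
      have e2 : ∑ t ∈ T, ind D'ᶜ (t • x) = T.card - ∑ t ∈ T, ind D' (t • x) := by
        simp [ind_compl]
      rw [e1, e2]
      have := mul_nonneg hTc.le (ind_nonneg b x)
      linarith [hcov' x]
  have s1 := (UpperDensityLE.sum T fun t _ =>
    UpperDensityLE.sub_smul (abs_ind_le_one D'ᶜ) t).const_mul (inv_nonneg.2 hTc.le)
  have s2 := (UpperDensityLE.sum T fun t _ =>
    hDu.comp_smul (abs_ind_le_one Dᶜ) t).const_mul
      (mul_nonneg (show 0 ≤ 1 - ε by linarith) (inv_nonneg.2 hTc.le))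
  refine ((s1.add s2).add hbd).mono (fun x => ?_) (le_of_eq ?_)
  · rw [Finset.sum_sub_distrib, Finset.sum_const, nsmul_eq_mul]
    have k := mul_le_mul_of_nonneg_left (key x) (inv_nonneg.2 hTc.le)
    have e1 : (T.card : ℝ)⁻¹ * ((1 - ε) * ∑ t ∈ T, ind Dᶜ (t • x) + T.card * ind b x) =
        (1 - ε) * (T.card : ℝ)⁻¹ * ∑ t ∈ T, ind Dᶜ (t • x) + ind b x := by
      field_simp
    have e2 : (T.card : ℝ)⁻¹ * (T.card * ind D'ᶜ x - ∑ t ∈ T, ind D'ᶜ (t • x)) =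
        ind D'ᶜ x - (T.card : ℝ)⁻¹ * ∑ t ∈ T, ind D'ᶜ (t • x) := by
      field_simp
    linarith
  · rw [Finset.sum_const, Finset.sum_const, nsmul_eq_mul, nsmul_eq_mul]
    field_simp
    rw [hη]
    ring

/-- Each step shrinks the uncovered density by nearly the factor `1 - ε`. The induction quantifies
over all Følner properties `p`, because a step strengthens the property required of the preceding
tiles. -/
theorem exists_isQuasiTiled (hfree : IsFreeAction G X)
    (hsbp : ∀ A U : Set X, IsClosed A → IsOpen U → A ⊆ U →
      ∃ O : Set X, IsOpen O ∧ A ⊆ O ∧ O ⊆ U ∧ NullFrontier G O)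
    {ε δ u : ℝ} (hε : 0 < ε) (hε1 : ε < 1) (hδ : 0 < δ) (hu : 0 < u)
    {p : Finset G → Prop} (hp : ∀ᶠ F in folner G, p F) :
    ∃ D : Set X, IsQuasiTiled p ε δ D ∧ UpperDensityLE G (ind Dᶜ) u := by
  have h : ∀ k : ℕ, ∀ u, (1 - ε) ^ k < u → ∀ p : Finset G → Prop, (∀ᶠ F in folner G, p F) →
      ∃ D : Set X, IsQuasiTiled p ε δ D ∧ UpperDensityLE G (ind Dᶜ) u := by
    intro k
    induction k with
    | zero =>
      intro u hu p _
      refine ⟨∅, isQuasiTiled_empty p ε δ, UpperDensityLE.of_le G fun x => ?_⟩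
      exact (ind_le_one _ _).trans (by simpa using hu.le)
    | succ k ih =>
      intro u' hu' p hp
      have h1 : 0 < 1 - ε := by linarith
      obtain ⟨u, hu1, hu2⟩ := exists_between (show (1 - ε) ^ k < u' / (1 - ε) by
        rw [lt_div_iff₀ h1, ← pow_succ]; exact hu')
      exact exists_isQuasiTiled_step hfree hsbp hε1 hδ
        (by rwa [lt_div_iff₀ h1, mul_comm] at hu2) (ih u hu1) hp
  obtain ⟨k, hk⟩ := exists_pow_lt_of_lt_one hu (show 1 - ε < 1 by linarith)
  exact h k u hk p hp

/-- Free actions with the small boundary property admit castles with invariant shapes and remainder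
of small density. -/
theorem exists_castle_upperDensityLE [Infinite G] (hfree : IsFreeAction G X)
    (hsbp : ∀ A U : Set X, IsClosed A → IsOpen U → A ⊆ U →
      ∃ O : Set X, IsOpen O ∧ A ⊆ O ∧ O ⊆ U ∧ NullFrontier G O)
    (K : Finset G) {δ u : ℝ} (hδ : 0 < δ) (hu : 0 < u) (n : ℕ) :
    ∃ (m : ℕ) (S : Fin m → Finset G) (V : Fin m → Set X), IsCastle S V ∧ (∀ i, IsOpen (V i)) ∧
      (∀ i, IsInvariant K δ (S i)) ∧ (∀ i, n ≤ (S i).card) ∧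
      (∀ i, ∀ s ∈ S i, diam (s • V i) < δ) ∧
      UpperDensityLE G (ind (⋃ i, footprint (S i) (V i))ᶜ) u := by
  -- The bound `1 / 2` gives `|T| ≤ 2 |E|`. The other bound makes the at most `ε |T|` deleted
  -- elements add at most `δ / 4 * |T|` to the boundary, as much as `T` itself contributes.
  set ε := min (1 / 2) (δ / 4 / (K.card + 1)) with hε
  have hε0 : 0 < ε := by positivity
  have hε2 : ε ≤ 1 / 2 := min_le_left _ _
  have hKε : K.card * ε ≤ δ / 4 := by
    have h1 : ε ≤ δ / 4 / (K.card + 1) := min_le_right _ _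
    rw [le_div_iff₀ (by positivity)] at h1
    linarith
  obtain ⟨D, ⟨ι, hι, T, E, V, h1, h2, h3, h4, h5, h6, h7, h8⟩, hDu⟩ :=
    exists_isQuasiTiled hfree hsbp hε0 (show ε < 1 by linarith) hδ hu
      ((eventually_isInvariant K (show 0 < δ / 4 by positivity)).and (eventually_le_card (2 * n)))
  have hTE : ∀ i, ((T i).card : ℝ) ≤ 2 * (E i).card := fun i => by
    have := h3 i
    have hc : (0 : ℝ) ≤ (T i).card := Nat.cast_nonneg _
    nlinarith
  obtain ⟨m, ⟨e⟩⟩ := Finite.exists_equiv_fin ι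
  refine ⟨m, fun i => E (e.symm i), fun i => interior (V (e.symm i)), ⟨fun i => ?_, fun i j hij => ?_⟩,
    fun i => isOpen_interior, fun i => ?_, fun i => ?_, fun i s hs => ?_, ?_⟩
  · exact (h5.1 _).mono le_rfl interior_subset
  · exact (h5.2 _ _ (by simpa using hij)).mono (footprint_mono le_rfl interior_subset)
      (footprint_mono le_rfl interior_subset)
  · set j := e.symm i
    have hsub : boundary K (E j) ⊆ boundary K (T j) ∪
        ((K ×ˢ (T j \ E j)).image fun q => q.1⁻¹ * q.2 : Finset G) := by
      rintro t ⟨⟨k, hk, hkt⟩, k', hk', hkt'⟩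
      by_cases hT : k' * t ∈ T j
      · right
        exact Finset.mem_coe.2 (Finset.mem_image.2 ⟨(k', k' * t), Finset.mem_product.2
          ⟨hk', Finset.mem_sdiff.2 ⟨hT, hkt'⟩⟩, by simp⟩)
      · exact Or.inl ⟨⟨k, hk, h2 j hkt⟩, k', hk', hT⟩
    have c1 : (boundary K (E j)).ncard ≤ (boundary K (T j)).ncard + K.card * (T j \ E j).card := by
      refine (Set.ncard_le_ncard hsub ((boundary_finite _ _).union (Finset.finite_toSet _))).trans
        ((Set.ncard_union_le _ _).trans (Nat.add_le_add_left ?_ _))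
      rw [Set.ncard_coe_finset, ← Finset.card_product]
      exact Finset.card_image_le
    have c2 : ((T j \ E j).card : ℝ) ≤ ε * (T j).card := by
      have := Finset.card_sdiff_add_card_eq_card (h2 j)
      have h9 : ((T j \ E j).card : ℝ) + (E j).card = (T j).card := by exact_mod_cast this
      linarith [h3 j]
    have c3 : ((boundary K (E j)).ncard : ℝ) ≤
        (boundary K (T j)).ncard + K.card * ((T j \ E j).card : ℝ) := by exact_mod_cast c1
    have c4 : ((boundary K (T j)).ncard : ℝ) ≤ δ / 4 * (T j).card := (h1 j).1
    have c5 : (K.card : ℝ) * ((T j \ E j).card : ℝ) ≤ δ / 4 * (T j).card := by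
      refine (mul_le_mul_of_nonneg_left c2 (Nat.cast_nonneg _)).trans ?_
      rw [← mul_assoc]
      gcongr
    have c6 := mul_le_mul_of_nonneg_left (hTE j) (show 0 ≤ δ / 2 by positivity)
    unfold IsInvariant
    linarith
  · have c1 := hTE (e.symm i)
    have c2 : ((2 * n : ℕ) : ℝ) ≤ (T (e.symm i)).card := Nat.cast_le.2 (h1 (e.symm i)).2
    push_cast at c2
    have : (n : ℝ) ≤ (E (e.symm i)).card := by linarith
    exact_mod_cast this
  · exact (diam_mono (Set.smul_set_mono interior_subset) isBounded_of_compactSpace).trans_lt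
      (h6 _ s hs)
  · have d1 := UpperDensityLE.sum (Finset.univ : Finset (Fin m)) fun i _ =>
      UpperDensityLE.sum (E (e.symm i)) fun s _ =>
        (h4 (e.symm i)).comp_smul (abs_ind_le_one _) s⁻¹
    refine (hDu.add d1).mono (fun x => ?_) (by simp)
    simp only [← ind_smul]
    rw [Finset.sum_sigma']
    by_cases hxD : x ∈ D
    · refine le_trans (ind_iUnion_le _
        (fun q : (_ : Fin m) × G => q.2 • frontier (V (e.symm q.1)))
        (D ∩ (⋃ i, footprint (E (e.symm i)) (interior (V (e.symm i))))ᶜ) ?_ x |>.trans' ?_)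
        (le_add_of_nonneg_left (ind_nonneg _ _))
      · rintro y ⟨hy, hy'⟩
        rw [h7] at hy
        obtain ⟨i, hi⟩ := Set.mem_iUnion.1 hy
        obtain ⟨s, hs, v, hv, rfl⟩ := mem_footprint.1 hi
        refine Set.mem_iUnion₂.2 ⟨⟨e i, s⟩, by simpa using hs, v, ?_, rfl⟩
        simp only [Equiv.symm_apply_apply]
        refine ⟨subset_closure hv, fun hint => hy' ?_⟩
        exact Set.mem_iUnion.2 ⟨e i, mem_footprint.2 ⟨s, by simpa using hs, v,
          by simpa using hint, rfl⟩⟩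
      · by_cases hx : x ∈ (⋃ i, footprint (E (e.symm i)) (interior (V (e.symm i))))ᶜ
        · rw [ind_of_mem hx, ind_of_mem (Set.mem_inter hxD hx)]
        · rw [ind_of_notMem hx]; exact ind_nonneg _ _
    · rw [ind_of_mem (show x ∈ Dᶜ from hxD)]
      exact (ind_le_one _ _).trans (le_add_of_nonneg_right
        (Finset.sum_nonneg fun q _ => ind_nonneg _ _))

end QuasiTiling

/-! ### Almost finiteness of the extension -/

section Extension

open Filter Topology Metric

variable {G : Type*} [Group G] {X : Type*} [MetricSpace X] [MulAction G X]
  [ContinuousConstSMul G X] {H : Subgroup G}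

/-- A clopen marker set for the generator `g`, invariant under `H`. -/
theorem exists_marker [H.Normal] {g : G} {m : ℕ} {P : Fin m → Set X} (hP : ∀ i, IsClopen (P i))
    (hPinv : ∀ i x, ∀ h : H, h • x ∈ P i ↔ x ∈ P i) {N : ℕ} (hN : 0 < N)
    (hPg : ∀ i, ∀ x ∈ P i, ∀ k : ℕ, 0 < k → k < N → g ^ k • x ∉ P i) (I : Finset (Fin m)) :
    ∃ U : Set X, IsClopen U ∧ (∀ x, ∀ h : H, h • x ∈ U ↔ x ∈ U) ∧
      (∀ x ∈ U, ∀ k : ℕ, 0 < k → k < N → g ^ k • x ∉ U) ∧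
      ∀ i ∈ I, ∀ x ∈ P i, ∃ k ∈ Finset.Ioo (-N : ℤ) N, g ^ k • x ∈ U := by
  induction I using Finset.induction_on with
  | empty => exact ⟨∅, isClopen_empty, by simp, by simp, by simp⟩
  | insert i I hi ih =>
    obtain ⟨U, hU, hinv, hdis, hcov⟩ := ih
    -- Greedy enlargement: add the points of `P i` whose `g`-orbit does not meet the current marker
    -- at any time strictly between `-N` and `N`.
    set Q : Set X := P i ∩ ⋂ k ∈ Finset.Ioo (-N : ℤ) N, (fun x => g ^ k • x) ⁻¹' Uᶜ with hQ
    have hmem : ∀ x, x ∈ Q ↔ x ∈ P i ∧ ∀ k ∈ Finset.Ioo (-N : ℤ) N, g ^ k • x ∉ U := fun x => by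
      simp [hQ]
    have hcomm : ∀ (k : ℤ) (h : H) (x : X), g ^ k • h • x =
        (MulAut.conjNormal (g ^ k) h : H) • g ^ k • x := fun k h x => by
      rw [Subgroup.smul_def, Subgroup.smul_def, MulAut.conjNormal_apply, smul_smul, smul_smul]
      congr 1
      group
    refine ⟨U ∪ Q, hU.union ((hP i).inter (isClopen_biInter_finset fun k _ =>
      hU.compl.preimage (continuous_const_smul _))), fun x h => ?_, ?_, ?_⟩
    · rw [Set.mem_union, Set.mem_union, hinv, hmem, hmem, hPinv]
      refine or_congr_right (and_congr_right fun _ => forall₂_congr fun k _ => ?_)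
      rw [hcomm, hinv]
    · rintro x (hx | hx) k hk hkN (hk' | hk')
      · exact hdis x hx k hk hkN hk'
      · refine ((hmem _).1 hk').2 (-k) (Finset.mem_Ioo.2 ⟨by omega, by omega⟩) ?_
        rwa [zpow_neg, zpow_natCast, inv_smul_smul]
      · refine ((hmem _).1 hx).2 k (Finset.mem_Ioo.2 ⟨by omega, by omega⟩) ?_
        rwa [zpow_natCast]
      · exact hPg i x ((hmem _).1 hx).1 k hk hkN ((hmem _).1 hk').1
    · intro j hj x hx
      by_cases hex : ∃ k ∈ Finset.Ioo (-N : ℤ) N, g ^ k • x ∈ U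
      · obtain ⟨k, hk, hkU⟩ := hex
        exact ⟨k, hk, Or.inl hkU⟩
      · rcases Finset.mem_insert.1 hj with rfl | hj
        · push Not at hex
          refine ⟨0, Finset.mem_Ioo.2 ⟨by omega, by omega⟩, Or.inr ?_⟩
          rw [zpow_zero, one_smul]
          exact (hmem x).2 ⟨hx, hex⟩
        · exact (hex (hcov j hj x hx)).elim

variable [CompactSpace X]

/-- The small boundary property transfers from `H` to `G` and yields a castle with small remainder;
comparison for the extension then moves the remainder into a proportion about `1 / n` of each
column. -/
theorem AlmostFinite.extension_of_infinite [H.Normal] [Infinite H] [Nonempty X]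
    (hfree : IsFreeAction G X) (hH : AlmostFinite H X) {g : G} (hg : ∀ k : ℤ, g ^ k ∈ H → k = 0)
    (hgen : ∀ x : G, ∃ k : ℤ, ∃ h : H, x = g ^ k * h) : AlmostFinite G X := by
  have := hH.neBot_folner
  have : Infinite G := Infinite.of_injective _ H.subtype_injective
  have : (folner G).NeBot := by
    refine neBot_iff.2 fun hbot => ?_
    obtain ⟨N, -, E, -, hf⟩ := exists_box_of_eventually hg hgen (p := fun _ => False) (by simp [hbot])
    exact hf
  have hsbp : ∀ A U : Set X, IsClosed A → IsOpen U → A ⊆ U →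
      ∃ O : Set X, IsOpen O ∧ A ⊆ O ∧ O ⊆ U ∧ NullFrontier G O := by
    intro A U hA hU hAU
    obtain ⟨O, h1, h2, h3, h4⟩ := hH.exists_nullFrontier hA hU hAU
    exact ⟨O, h1, h2, h3, UpperDensityLE.of_subgroup (abs_ind_le_one _) h4⟩
  intro n hn K δ hδ
  have hn' : (0 : ℝ) < n := Nat.cast_pos.2 hn
  have hn1 : (1 : ℝ) ≤ n := by exact_mod_cast hn
  obtain ⟨m, S, V, hc, hV, hS, hcard, hdiam, hdens⟩ := exists_castle_upperDensityLE hfree hsbp K hδ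
    (show (0 : ℝ) < 1 / (8 * n) by positivity) n
  choose S' hS' hS'c using fun i => Finset.exists_subset_card_eq (Nat.div_le_self (S i).card n)
  refine ⟨m, S, V, hc, hV, hS, hdiam, S', hS', fun i => ?_, ?_⟩
  · rw [hS'c]
    exact Nat.cast_div_le
  -- Since `|S| ≥ n`, rounding `|S| / n` down loses less than a factor two. The levels of `S'` thus
  -- have density about `1 / (2n)`, against at most `1 / (8n)` for the remainder.
  have h1 := UpperDensityLE.of_card_le S S' (2 * n) V (fun i => by
    rw [hS'c]
    have hq : 1 ≤ (S i).card / n := (Nat.one_le_div_iff hn).2 (hcard i)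
    have hlt : (S i).card < n * ((S i).card / n) + n := Nat.lt_mul_div_succ _ hn
    have : (S i).card ≤ 2 * n * ((S i).card / n) := by nlinarith
    exact_mod_cast this)
  have hsub := hH.subequiv_extension hg hgen (isClosed_remainder S hV)
    (B := ⋃ i, footprint (S' i) (V i)) (isOpen_iUnion fun i => isOpen_footprint (S' i) (hV i))
    (c := -(1 / (4 * n) : ℝ)) (neg_neg_of_pos (by positivity)) ?_
  · exact hsub
  have h2 := (h1.const_mul (show (0 : ℝ) ≤ 1 / (2 * n) by positivity)).add
    ((hdens.const_mul (show (0 : ℝ) ≤ 1 + 1 / (2 * n) by positivity)).add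
      (UpperDensityLE.of_le G (f := fun _ : X => -(1 / (2 * n) : ℝ)) fun _ => le_rfl))
  refine h2.mono (fun x => le_of_eq ?_) ?_
  · rw [hc.sum_ind, (hc.mono hS' fun i => le_rfl).sum_ind, ind_compl]
    field_simp
    ring
  · have e1 : (1 : ℝ) / (2 * n) ≤ 1 := by
      rw [div_le_one (by positivity)]; linarith
    have e2 : (0 : ℝ) < 1 / (8 * n) := by positivity
    have e3 : (1 : ℝ) / (2 * n) = 4 * (1 / (8 * n)) := by field_simp; norm_num
    have e4 : (1 : ℝ) / (4 * n) = 2 * (1 / (8 * n)) := by field_simp; norm_num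
    nlinarith

/-- An almost finite action of a finite group has castles without remainder. -/
theorem AlmostFinite.exists_castle_univ {Γ : Type*} [Group Γ] [Fintype Γ] {Y : Type*}
    [MetricSpace Y] [MulAction Γ Y] [ContinuousConstSMul Γ Y] (h : AlmostFinite Γ Y) {δ : ℝ}
    (hδ : 0 < δ) :
    ∃ (m : ℕ) (V : Fin m → Set Y), IsCastle (fun _ => (Finset.univ : Finset Γ)) V ∧
      (∀ i, IsOpen (V i)) ∧ (∀ i, ∀ s : Γ, Metric.diam (s • V i) < δ) ∧
      ⋃ i, footprint (Finset.univ : Finset Γ) (V i) = Set.univ := by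
  have hc : (0 : ℝ) < 1 / (Fintype.card Γ + 1) := by positivity
  -- Requiring more than `|Γ|` parts forces `S'` to be empty, hence the remainder too. The
  -- invariance constant makes boundaries empty, so every nonempty shape is all of `Γ`.
  obtain ⟨m, S, V, hcas, hV, hS, hdiam, S', hS', hcard, hsub⟩ := h (Fintype.card Γ + 1)
    (Nat.succ_pos _) Finset.univ (min δ (1 / (Fintype.card Γ + 1))) (lt_min hδ hc)
  have hlt : ∀ i, ((S i).card : ℝ) / (Fintype.card Γ + 1) < 1 := fun i => by
    rw [div_lt_one (by positivity)]
    exact_mod_cast Nat.lt_succ_of_le (Finset.card_le_univ (S i))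
  have hSu : ∀ i, (S i).Nonempty → S i = Finset.univ := by
    rintro i ⟨s, hs⟩
    have h1 : ((boundary Finset.univ (S i)).ncard : ℝ) < 1 := by
      refine (hS i).trans_lt (lt_of_le_of_lt ?_ (hlt i))
      exact (mul_le_mul_of_nonneg_right (min_le_right _ _) (Nat.cast_nonneg _)).trans_eq
        (one_div_mul_eq_div _ _)
    have h2 : boundary Finset.univ (S i) = ∅ := by
      rw [← Set.ncard_eq_zero (boundary_finite _ _)]
      have : (boundary Finset.univ (S i)).ncard < 1 := by exact_mod_cast h1
      omega
    refine Finset.eq_univ_of_forall fun t => ?_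
    by_contra ht
    have : s ∈ boundary Finset.univ (S i) :=
      ⟨⟨1, by simp, by simpa using hs⟩, t * s⁻¹, by simp, by simpa using ht⟩
    rw [h2] at this
    exact this
  have hS'e : ∀ i, S' i = ∅ := fun i => by
    have h1 := hcard i
    push_cast at h1
    have h2 : ((S' i).card : ℝ) < 1 := h1.trans_lt (hlt i)
    rw [← Finset.card_eq_zero]
    have : (S' i).card < 1 := by exact_mod_cast h2
    omega
  have hcov : ∀ x : Y, x ∈ ⋃ i, footprint (S i) (V i) := by
    intro x
    by_contra hx
    obtain ⟨p, U, s, -, hU, -, hUs⟩ := hsub _ (isClosed_remainder S hV) le_rfl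
    obtain ⟨k, hk⟩ := Set.mem_iUnion.1 (hU hx)
    have := hUs k (Set.smul_mem_smul_set hk)
    simp [footprint, hS'e] at this
  -- An empty shape puts no condition on its base, which must be discarded before the shape is
  -- enlarged to `Γ`.
  let W : Fin m → Set Y := fun i => if (S i).Nonempty then V i else ∅
  have hW : ∀ i, W i ⊆ V i := fun i => by
    simp only [W]; split_ifs <;> simp
  have hWm : ∀ i x, x ∈ W i → S i = Finset.univ := fun i x hx => by
    simp only [W] at hx
    split_ifs at hx with hne
    · exact hSu i hne
    · exact hx.elim
  have hfoot : ∀ i, footprint (Finset.univ : Finset Γ) (W i) ⊆ footprint (S i) (V i) := fun i x hx => by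
    obtain ⟨s, -, v, hv, rfl⟩ := mem_footprint.1 hx
    exact mem_footprint.2 ⟨s, by rw [hWm i v hv]; simp, v, hW i hv, rfl⟩
  refine ⟨m, W, ⟨fun i s _ t _ hst => ?_, fun i j hij => (hcas.2 i j hij).mono (hfoot i) (hfoot j)⟩,
    fun i => ?_, fun i s => ?_, Set.eq_univ_of_forall fun x => ?_⟩
  · refine Set.disjoint_left.2 fun x hx hx' => ?_
    obtain ⟨v, hv, rfl⟩ := hx
    have hu := hWm i v hv
    exact Set.disjoint_left.1 (hcas.1 i s (by rw [hu]; simp) t (by rw [hu]; simp) hst)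
      (Set.smul_mem_smul_set (hW i hv)) (Set.smul_set_mono (hW i) hx')
  · simp only [W]
    split_ifs
    exacts [hV i, isOpen_empty]
  · simp only [W]
    split_ifs with hne
    · exact (hdiam i s (by rw [hSu i hne]; simp)).trans_le (min_le_left _ _)
    · simpa using hδ
  · obtain ⟨i, hi⟩ := Set.mem_iUnion.1 (hcov x)
    obtain ⟨s, hs, hx⟩ := mem_footprint.1 hi
    refine Set.mem_iUnion.2 ⟨i, mem_footprint.2 ⟨s, by simp, ?_⟩⟩
    simp only [W]
    rwa [if_pos ⟨s, hs⟩]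

/-- Cut each `g`-orbit at its visits to a clopen `H`-invariant marker set. Segments between
successive visits, multiplied by the whole of `H`, are boxes, and they exhaust the space. -/
theorem AlmostFinite.extension_of_finite [H.Normal] [Finite H]
    (hfree : IsFreeAction G X) (hH : AlmostFinite H X) {g : G} (hg : ∀ k : ℤ, g ^ k ∈ H → k = 0)
    (hgen : ∀ x : G, ∃ k : ℤ, ∃ h : H, x = g ^ k * h) : AlmostFinite G X := by
  have := Fintype.ofFinite H
  intro n hn K δ hδ
  obtain ⟨N₀, hN₀⟩ := exists_box_isInvariant hg hgen K hδ
  -- As a subset of itself, the finite group `H` has empty boundary and satisfies every Følner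
  -- condition.
  have hbox : ∀ N ≥ N₀, IsInvariant K δ (box g N (Finset.univ : Finset H)) := by
    intro N hN
    obtain ⟨K', δ', hδ', h⟩ := eventually_folner.1 (hN₀ N hN)
    refine h _ ⟨1, by simp⟩ ?_
    have : boundary K' (Finset.univ : Finset H) = ∅ := by
      refine Set.eq_empty_of_forall_notMem fun t ht => ?_
      obtain ⟨-, k, -, hk⟩ := ht
      exact hk (by simp)
    rw [IsInvariant, this, Set.ncard_empty, Nat.cast_zero]
    positivity
  set N := N₀ + 1 with hNdef
  have hN : 0 < N := by omega
  obtain ⟨ρ, hρ, hsmall⟩ := hfree.exists_isTower (box g (2 * N) (Finset.univ : Finset H)) hδ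
  obtain ⟨m, V, hcas, hV, hVd, hcov⟩ := hH.exists_castle_univ hρ
  have hVt : ∀ i, IsTower (box g (2 * N) (Finset.univ : Finset H)) (V i) ∧
      ∀ t ∈ box g (2 * N) (Finset.univ : Finset H), diam (t • V i) < δ := fun i =>
    hsmall _ fun x hx y hy => by
      have h1 := hVd i 1
      rw [one_smul] at h1
      exact (dist_le_diam_of_mem isBounded_of_compactSpace hx hy).trans_lt h1
  set P : Fin m → Set X := fun i => footprint (Finset.univ : Finset H) (V i) with hP
  have hPm : ∀ i x, x ∈ P i ↔ ∃ h : H, ∃ v ∈ V i, h • v = x := fun i x => by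
    simp [hP, mem_footprint, Set.mem_smul_set]
  have hPo : ∀ i, IsOpen (P i) := fun i => isOpen_footprint _ (hV i)
  have hPex : ∀ x, ∃ i, x ∈ P i := fun x => Set.mem_iUnion.1 (hcov ▸ Set.mem_univ x)
  have hPc : ∀ i, IsClopen (P i) := fun i => by
    refine ⟨⟨?_⟩, hPo i⟩
    have : (P i)ᶜ = ⋃ j, ⋃ _ : j ≠ i, P j := by
      ext x
      simp only [Set.mem_compl_iff, Set.mem_iUnion]
      constructor
      · intro hx
        obtain ⟨j, hj⟩ := hPex x
        exact ⟨j, fun h => hx (h ▸ hj), hj⟩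
      · rintro ⟨j, hji, hj⟩ hi
        exact Set.disjoint_left.1 (hcas.2 j i hji) hj hi
    rw [this]
    exact isOpen_iUnion fun j => isOpen_iUnion fun _ => hPo j
  have hPinv : ∀ i x, ∀ h : H, h • x ∈ P i ↔ x ∈ P i := by
    intro i x h
    rw [hPm, hPm]
    constructor
    · rintro ⟨h', v, hv, he⟩
      exact ⟨h⁻¹ * h', v, hv, by rw [mul_smul, he, inv_smul_smul]⟩
    · rintro ⟨h', v, hv, rfl⟩
      exact ⟨h * h', v, hv, mul_smul _ _ _⟩
  have hbm : ∀ (j : ℕ) (h : H), j < 2 * N → g ^ j * (h : G) ∈ box g (2 * N) Finset.univ :=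
    fun j h hj => mem_box.2 ⟨j, hj, h, by simp, rfl⟩
  have hPg : ∀ i, ∀ x ∈ P i, ∀ k : ℕ, 0 < k → k < N → g ^ k • x ∉ P i := by
    intro i x hx k hk hkN hk'
    obtain ⟨h, v, hv, rfl⟩ := (hPm _ _).1 hx
    obtain ⟨h', v', hv', he⟩ := (hPm _ _).1 hk'
    have h1 := (hVt i).1.unique (hbm 0 h' (by omega)) (hbm k h (by omega)) hv' hv (by
      rw [pow_zero, one_mul, mul_smul]; exact he)
    have h2 := pow_mul_injective hg (a₁ := (0, h')) (a₂ := (k, h)) h1.1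
    have h3 : 0 = k := congrArg Prod.fst h2
    omega
  obtain ⟨U, hU, hinv, hdis, hmark⟩ := exists_marker hPc hPinv hN hPg Finset.univ
  have hmark' : ∀ x, ∃ k ∈ Finset.Ioo (-N : ℤ) N, g ^ k • x ∈ U := fun x => by
    obtain ⟨i, hi⟩ := hPex x
    exact hmark i (by simp) x hi
  have hcomm : ∀ (k : ℕ) (h : H) (x : X), g ^ k • h • x =
      (MulAut.conjNormal (g ^ k) h : H) • g ^ k • x := fun k h x => by
    rw [Subgroup.smul_def, Subgroup.smul_def, MulAut.conjNormal_apply, smul_smul, smul_smul]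
    congr 1
    group
  -- For positive `r`, these are the points of the marker whose first return along `g` occurs at
  -- time `r`.
  set R : ℕ → Set X := fun r =>
    (U ∩ (fun x => g ^ r • x) ⁻¹' U) ∩ ⋂ j ∈ Finset.Ioo 0 r, (fun x => g ^ j • x) ⁻¹' Uᶜ with hR
  have hRm : ∀ r x, x ∈ R r ↔ x ∈ U ∧ g ^ r • x ∈ U ∧ ∀ j : ℕ, 0 < j → j < r → g ^ j • x ∉ U :=
    fun r x => by simp [hR, and_assoc]
  have hRo : ∀ r, IsOpen (R r) := fun r =>
    ((hU.inter (hU.preimage (continuous_const_smul _))).inter (isClopen_biInter_finset fun j _ =>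
      hU.compl.preimage (continuous_const_smul _))).isOpen
  have hRinv : ∀ r x, ∀ h : H, h • x ∈ R r ↔ x ∈ R r := fun r x h => by
    simp only [hRm, hcomm, hinv]
  let ι := Fin m × {r // r ∈ Finset.Ico N (2 * N)}
  have hr : ∀ q : ι, N ≤ q.2.1 ∧ q.2.1 < 2 * N := fun q => Finset.mem_Ico.1 q.2.2
  let S : ι → Finset G := fun q => box g q.2.1 (Finset.univ : Finset H)
  let W : ι → Set X := fun q => V q.1 ∩ R q.2.1
  have hSsub : ∀ q, S q ⊆ box g (2 * N) (Finset.univ : Finset H) := fun q x hx => by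
    obtain ⟨j, hj, h, hh, rfl⟩ := mem_box.1 hx
    exact hbm j h (hj.trans (hr q).2)
  have hdisj : ∀ q q' : ι, ∀ x, x ∈ footprint (S q) (W q) → x ∈ footprint (S q') (W q') →
      q = q' := by
    intro q q' x hx hx'
    obtain ⟨s, hs, v, hv, rfl⟩ := mem_footprint.1 hx
    obtain ⟨s', hs', v', hv', he⟩ := mem_footprint.1 hx'
    obtain ⟨j, hj, h, -, rfl⟩ := mem_box.1 hs
    obtain ⟨j', hj', h', -, rfl⟩ := mem_box.1 hs'
    simp only [mul_smul] at he
    have hu := (hRm _ _).1 ((hRinv _ _ h).2 hv.2)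
    have hu' := (hRm _ _).1 ((hRinv _ _ h').2 hv'.2)
    have hstep : ∀ a b : ℕ, a < b → ∀ y z : X, g ^ a • y = g ^ b • z → y = g ^ (b - a) • z := by
      intro a b hab y z hyz
      rw [← Nat.add_sub_of_le hab.le, pow_add, mul_smul] at hyz
      simpa using smul_left_cancel _ hyz
    -- Unequal heights would place one base point strictly between another and its first return to
    -- `U`.
    have hjj : j = j' := by
      rcases lt_trichotomy j j' with hlt | heq | hlt
      · have h1 := hstep j j' hlt _ _ he.symm
        refine (hu'.2.2 (j' - j) (by omega) (by omega) ?_).elim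
        have h2 := hu.1
        rw [Subgroup.smul_def, h1] at h2
        exact h2
      · exact heq
      · have h1 := hstep j' j hlt _ _ he
        refine (hu.2.2 (j - j') (by omega) (by omega) ?_).elim
        have h2 := hu'.1
        rw [Subgroup.smul_def, h1] at h2
        exact h2
    subst hjj
    have huu : h' • v' = h • v := smul_left_cancel _ he
    have hi : q.1 = q'.1 := by
      by_contra hne
      refine Set.disjoint_left.1 (hcas.2 _ _ hne) ((hPm q.1 (h • v)).2 ⟨h, v, hv.1, rfl⟩) ?_
      exact (hPm q'.1 _).2 ⟨h', v', hv'.1, huu⟩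
    rw [huu] at hu'
    have hrr : q.2.1 = q'.2.1 := by
      rcases lt_trichotomy q.2.1 q'.2.1 with hlt | heq | hlt
      · exact (hu'.2.2 _ (by have := (hr q).1; omega) hlt hu.2.1).elim
      · exact heq
      · exact (hu.2.2 _ (by have := (hr q').1; omega) hlt hu'.2.1).elim
    exact Prod.ext hi (Subtype.ext hrr)
  have hcover : ∀ x, ∃ q : ι, x ∈ footprint (S q) (W q) := by
    intro x
    -- Go back to the last visit `u` to the marker, `k` steps earlier, and let `r` be its first
    -- return time. Separation of the marker gives `r ≥ N`; a visit within distance less than `N` of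
    -- `g ^ N • u` gives `r < 2 * N`. Minimality of `k` gives `k < r`.
    have hback : ∃ k : ℕ, (g ^ k)⁻¹ • x ∈ U := by
      obtain ⟨k, hk, hkU⟩ := hmark' ((g ^ N)⁻¹ • x)
      rw [Finset.mem_Ioo] at hk
      refine ⟨(N - k).toNat, ?_⟩
      rw [← zpow_natCast g (N - k).toNat, Int.toNat_of_nonneg (by omega)]
      rwa [smul_smul, ← zpow_natCast g N, ← zpow_neg, ← zpow_add,
        show k + -(N : ℤ) = -(N - k) by ring, zpow_neg] at hkU
    set k := Nat.find hback
    have hk : (g ^ k)⁻¹ • x ∈ U := Nat.find_spec hback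
    set u := (g ^ k)⁻¹ • x with hu
    have hret : ∃ r : ℕ, 0 < r ∧ g ^ r • u ∈ U := by
      obtain ⟨l, hl, hlU⟩ := hmark' (g ^ N • u)
      rw [Finset.mem_Ioo] at hl
      refine ⟨(N + l).toNat, by omega, ?_⟩
      rw [← zpow_natCast g (N + l).toNat, Int.toNat_of_nonneg (by omega)]
      rwa [smul_smul, ← zpow_natCast g N, ← zpow_add, add_comm] at hlU
    set r := Nat.find hret
    obtain ⟨hr0, hrU⟩ : 0 < r ∧ g ^ r • u ∈ U := Nat.find_spec hret
    have hrN : N ≤ r := by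
      by_contra hlt
      exact hdis u hk r hr0 (by omega) hrU
    have hr2 : r < 2 * N := by
      obtain ⟨l, hl, hlU⟩ := hmark' (g ^ N • u)
      rw [Finset.mem_Ioo] at hl
      refine lt_of_le_of_lt (Nat.find_min' hret (m := (N + l).toNat) ⟨by omega, ?_⟩) (by omega)
      rw [← zpow_natCast g (N + l).toNat, Int.toNat_of_nonneg (by omega)]
      rwa [smul_smul, ← zpow_natCast g N, ← zpow_add, add_comm] at hlU
    have hkr : k < r := by
      by_contra hle
      push Not at hle
      refine Nat.find_min hback (m := k - r) (by omega) ?_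
      have e : g ^ r • u = (g ^ (k - r))⁻¹ • x := by
        rw [hu, smul_smul]
        congr 1
        have h1 : g ^ k = g ^ (k - r) * g ^ r := by rw [← pow_add, Nat.sub_add_cancel hle]
        rw [h1, mul_inv_rev, mul_inv_cancel_left]
      rwa [← e]
    have huR : u ∈ R r := (hRm _ _).2 ⟨hk, hrU, fun j hj hjr hjU =>
      Nat.find_min hret hjr ⟨hj, hjU⟩⟩
    obtain ⟨i, hi⟩ := hPex u
    obtain ⟨h, v, hv, hvu⟩ := (hPm _ _).1 hi
    refine ⟨(i, ⟨r, Finset.mem_Ico.2 ⟨hrN, hr2⟩⟩), mem_footprint.2 ⟨g ^ k * (h : G),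
      mem_box.2 ⟨k, hkr, h, by simp, rfl⟩, v, ⟨hv, ?_⟩, ?_⟩⟩
    · rw [← hvu, hRinv] at huR
      exact huR
    · simp only [mul_smul]
      rw [← Subgroup.smul_def, hvu, hu, smul_inv_smul]
  obtain ⟨M, ⟨e⟩⟩ := Finite.exists_equiv_fin ι
  refine ⟨M, fun i => S (e.symm i), fun i => W (e.symm i), ⟨fun i => ?_, fun i j hij => ?_⟩,
    fun i => (hV _).inter (hRo _), fun i => ?_, fun i s hs => ?_, fun _ => ∅, by simp,
    fun i => by simp only [Finset.card_empty, Nat.cast_zero]; positivity, fun C _ hC => ?_⟩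
  · exact (hVt _).1.mono (hSsub _) Set.inter_subset_left
  · exact Set.disjoint_left.2 fun x hx hx' => hij (e.symm.injective (hdisj _ _ x hx hx'))
  · exact hbox _ (by have := (hr (e.symm i)).1; omega)
  · exact (diam_mono (Set.smul_set_mono Set.inter_subset_left)
      isBounded_of_compactSpace).trans_lt ((hVt _).2 s (hSsub _ hs))
  · refine ⟨0, Fin.elim0, Fin.elim0, fun i => i.elim0, fun x hx => ?_, fun i => i.elim0,
      fun i => i.elim0⟩
    obtain ⟨q, hq⟩ := hcover x
    exact (hC hx (Set.mem_iUnion.2 ⟨e q, by simpa using hq⟩)).elim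

end Extension

end DynAlmostFinite

/-! ### The semidirect product as an extension by the integers -/

theorem mainTheorem2 {H : Type*} [Group H] [Countable H] (α : MulAut H)
    {X : Type*} [MetricSpace X] [CompactSpace X]
    [MulAction (DynAlmostFinite.SemidirectInt H α) X]
    [ContinuousConstSMul (DynAlmostFinite.SemidirectInt H α) X]
    (hfree : DynAlmostFinite.IsFreeAction (DynAlmostFinite.SemidirectInt H α) X)
    (hH : DynAlmostFinite.AlmostFinite (DynAlmostFinite.baseSubgroup H α) X) :
    DynAlmostFinite.AlmostFinite (DynAlmostFinite.SemidirectInt H α) X := by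
  have hker : DynAlmostFinite.baseSubgroup H α = SemidirectProduct.rightHom.ker :=
    SemidirectProduct.range_inl_eq_ker_rightHom
  have hnormal : (DynAlmostFinite.baseSubgroup H α).Normal := by
    rw [hker]
    infer_instance
  set g : DynAlmostFinite.SemidirectInt H α :=
    SemidirectProduct.inr (Multiplicative.ofAdd 1) with hgdef
  have hgpow : ∀ k : ℤ, g ^ k = SemidirectProduct.inr (Multiplicative.ofAdd k) := fun k => by
    rw [hgdef, ← map_zpow, ← ofAdd_zsmul]
    simp
  have hg : ∀ k : ℤ, g ^ k ∈ DynAlmostFinite.baseSubgroup H α → k = 0 := fun k hk => by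
    rw [hker, MonoidHom.mem_ker, hgpow, SemidirectProduct.rightHom_inr] at hk
    exact hk
  have hgen : ∀ x : DynAlmostFinite.SemidirectInt H α, ∃ k : ℤ,
      ∃ h : DynAlmostFinite.baseSubgroup H α, x = g ^ k * h := fun x => by
    refine ⟨Multiplicative.toAdd x.right, ⟨(g ^ (Multiplicative.toAdd x.right))⁻¹ * x, ?_⟩, ?_⟩
    · rw [hker, MonoidHom.mem_ker, hgpow, map_mul, map_inv, SemidirectProduct.rightHom_inr]
      simp [SemidirectProduct.rightHom]
    · simp
  rcases finite_or_infinite (DynAlmostFinite.baseSubgroup H α) with hfin | hinf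
  · exact hH.extension_of_finite hfree hg hgen
  -- Extracting Følner sets of `H` needs a point of `X`; for empty `X` the empty castle works.
  · rcases isEmpty_or_nonempty X with hX | hX
    · intro n _ K δ _
      refine ⟨0, Fin.elim0, Fin.elim0, ⟨fun i => i.elim0, fun i => i.elim0⟩, fun i => i.elim0,
        fun i => i.elim0, fun i => i.elim0, Fin.elim0, fun i => i.elim0, fun i => i.elim0,
        fun C _ _ => ⟨0, Fin.elim0, Fin.elim0, fun i => i.elim0, fun x => hX.elim x,
          fun i => i.elim0, fun i => i.elim0⟩⟩
    · exact hH.extension_of_infinite hfree hg hgen
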